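/- **Conventions.** Let $X$ be a topological space, $i\ge 0$ an integer, and $C_\bullet(X)$ the singular chain complex with integer coefficients. On $C_\bullet(X)\otimes C_\bullet(X)$ put $\partial(x\otimes y)=\partial x\otimes y+(-1)^{|x|}x\otimes\partial y$ and $T(x\otimes y)=(-1)^{|x||y|}y\otimes x$. For a singular simplex $\sigma\colon\Delta^p\to X$ and a non-empty $S\subseteq[0,p]=\{0,\dots,p\}$, let $\sigma|_S$ be the restriction of $\sigma$ to the face of $\Delta^p$ with vertex set $S$. For $L\subseteq[0,p]$, let $A_L$ be the set of those $a\in[0,p]\setminus L$ for which $|\{l\in L: l>a\}|$ is odd, and let $B_L=[0,p]\setminus(L\cup A_L)$. Define $\Delta_i^\emptyset\colon C_\bullet(X)\to C_\bullet(X)\otimes C_\bullet(X)$ by $$\Delta_i^\emptyset(\sigma)=\sum_{L\subseteq[0,p],\,|L|=i+1}(-1)^{\varepsilon_L}\,\sigma|_{L\cup A_L}\otimes\sigma|_{L\cup B_L},$$ $$\varepsilon_L=\sum_{b\in B_L}|\{a\in A_L:a<b\}|+\sum_{l\in L}|\{m\in L:m<l\}|+(p+1)|A_L|,$$ and put $\Delta_{-1}^\emptyset=0$.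 (Up to sign, $\Delta_i^\emptyset$ is the Steenrod cup-$i$ coproduct or its opposite.) A *dimension-only formula of degree $i$* is a family $\Phi=(\Phi_p)_{p\ge0}$ of finite formal sums $\Phi_p=\sum_{S,T}c^p_{S,T}\,S\otimes T$, with integers $c^p_{S,T}$, over non-empty $S,T\subseteq[0,p]$ with $(|S|-1)+(|T|-1)=p+i$. It defines a coproduct $\Delta^\Phi(\sigma)=\sum_{S,T}c^p_{S,T}\,\sigma|_S\otimes\sigma|_T$ on $C_\bullet(X)$. Its number of terms in dimension $p$ is the number of pairs $(S,T)$ with $c^p_{S,T}\ne0$. Call $\Phi$ *admissible for $X$* if $\Delta'=\Delta^\Phi$ satisfies $$\partial\circ\Delta'-(-1)^i\,\Delta'\circ\partial=(1+(-1)^iT)\,\Delta_{i-1}^\emptyset\quad\text{on } C_\bullet(X)$$ and, if $i=0$, also $\Delta'(\sigma)=\sigma\otimes\sigma$ for every singular $0$-simplex $\sigma$. **Theorem.** Suppose that $X$ has a path with two distinct end points. Let $\Delta'_i\colon C_\bullet(X)\to C_\bullet(X)\otimes C_\bullet(X)$ be a coproduct given by a dimension-only formula $\Phi$ of degree $i$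 that is admissible for $X$. Suppose that $\Phi$ has the minimal number of terms, i.e. in every dimension $p$ it has at most as many terms as any other dimension-only formula of degree $i$ admissible for $X$. Then $\Delta'_i=\Delta_i^\emptyset$ or $\Delta'_i=(-1)^i\,T\Delta_i^\emptyset$. -/

import Mathlib

open scoped TensorProduct

noncomputable section

namespace CupCoproduct

/-! ### Singular chains -/

/-- Singular `p`-simplices of `X`: continuous maps from the standard `p`-simplex to `X`. -/
abbrev SingularSimplex (X : Type*) [TopologicalSpace X] (p : ℕ) : Type _ :=
  C(stdSimplex ℝ (Fin (p + 1)), X)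

/-- The singular chains of `X`, as the direct sum over all degrees `p` of the free abelian groups
on the singular `p`-simplices. A basis element is a pair `⟨p, σ⟩`. -/
abbrev Chains (X : Type*) [TopologicalSpace X] : Type _ :=
  (Σ p : ℕ, SingularSimplex X p) →₀ ℤ

variable {X : Type*} [TopologicalSpace X]

/-- Instance selection only: the `ℤ`-module structures of `Chains X` and of its tensor square that
are to be found first (they agree with the structure that every abelian group has). -/
instance (priority := high) chainsModule : Module ℤ (Chains X) :=
  Finsupp.module _ ℤ

/-- See `chainsModule`. -/
instance (priority := high) tensorModule : Module ℤ (Chains X ⊗[ℤ] Chains X) :=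
  TensorProduct.instModule

/-- A singular simplex as a chain. -/
def simplexChain {p : ℕ} (σ : SingularSimplex X p) : Chains X :=
  Finsupp.single ⟨p, σ⟩ 1

/-- The order-preserving enumeration of a non-empty set of vertices. -/
def vertexMap {p : ℕ} (S : Finset (Fin (p + 1))) (hS : S.Nonempty) :
    Fin (S.card - 1 + 1) ↪o Fin (p + 1) :=
  S.orderEmbOfFin (Nat.sub_add_cancel hS.card_pos).symm

/-- The restriction of a singular simplex `σ` to the face of the standard simplex whose set of
vertices is the non-empty set `S`; it is a singular simplex of dimension `|S| - 1`. -/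
def face {p : ℕ} (σ : SingularSimplex X p) (S : Finset (Fin (p + 1))) (hS : S.Nonempty) :
    SingularSimplex X (S.card - 1) :=
  σ.comp ⟨stdSimplex.map (vertexMap S hS), stdSimplex.continuous_map _⟩

open Classical in
/-- The face of `σ` spanned by `S`, as a chain; the empty face is zero. -/
def faceChain {p : ℕ} (σ : SingularSimplex X p) (S : Finset (Fin (p + 1))) : Chains X :=
  if hS : S.Nonempty then simplexChain (face σ S hS) else 0

/-- The singular boundary map `∂ σ = ∑ j, (-1)^j σ|_{[0, p] \ j}`, which is zero on
`0`-simplices. -/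
def boundary (X : Type*) [TopologicalSpace X] : Chains X →ₗ[ℤ] Chains X :=
  Finsupp.linearCombination ℤ fun s =>
    ∑ j : Fin (s.1 + 1), (-1 : ℤ) ^ (j : ℕ) • faceChain s.2 (Finset.univ.erase j)

/-- The map `x ↦ (-1)^{|x|} x` on chains. -/
def degreeSign (X : Type*) [TopologicalSpace X] : Chains X →ₗ[ℤ] Chains X :=
  Finsupp.linearCombination ℤ fun s => (-1 : ℤ) ^ s.1 • simplexChain s.2

/-- The differential `∂ (x ⊗ y) = ∂ x ⊗ y + (-1)^{|x|} x ⊗ ∂ y`. -/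
def tensorBoundary (X : Type*) [TopologicalSpace X] :
    Chains X ⊗[ℤ] Chains X →ₗ[ℤ] Chains X ⊗[ℤ] Chains X :=
  TensorProduct.map (boundary X) LinearMap.id + TensorProduct.map (degreeSign X) (boundary X)

/-- The symmetry `T (x ⊗ y) = (-1)^{|x| |y|} y ⊗ x`. -/
def swap (X : Type*) [TopologicalSpace X] :
    Chains X ⊗[ℤ] Chains X →ₗ[ℤ] Chains X ⊗[ℤ] Chains X :=
  TensorProduct.lift <| Finsupp.linearCombination ℤ fun s =>
    Finsupp.linearCombination ℤ fun t =>
      (-1 : ℤ) ^ (s.1 * t.1) • (simplexChain t.2 ⊗ₜ[ℤ] simplexChain s.2)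

/-! ### The coproducts `Δ_i^∅` -/

/-- `|L_{>a}|`; the vertex `a` is an even or odd gap of `L` according to its parity. -/
def numAbove {p : ℕ} (L : Finset (Fin (p + 1))) (a : Fin (p + 1)) : ℕ :=
  (L.filter fun l => a < l).card

/-- `|L_{<a}|`. -/
def numBelow {p : ℕ} (L : Finset (Fin (p + 1))) (a : Fin (p + 1)) : ℕ :=
  (L.filter fun l => l < a).card

/-- The initial vertex `A_L^U` of the cube with generating vectors `L` in the cubillage of the
collection `U`: a vertex `a ∉ L` belongs to it iff `L ∪ {a} ∈ U` and `a` is an even gap of `L`, or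
`L ∪ {a} ∉ U` and `a` is an odd gap of `L`. -/
def initialVertex {p : ℕ} (U : Finset (Finset (Fin (p + 1)))) (L : Finset (Fin (p + 1))) :
    Finset (Fin (p + 1)) :=
  Finset.univ.filter fun a => a ∉ L ∧
    ((insert a L ∈ U ∧ Even (numAbove L a)) ∨ (insert a L ∉ U ∧ Odd (numAbove L a)))

/-- `B_L^U = [0, p] \ (L ∪ A_L^U)`. -/
def coInitialVertex {p : ℕ} (U : Finset (Finset (Fin (p + 1)))) (L : Finset (Fin (p + 1))) :
    Finset (Fin (p + 1)) :=
  (L ∪ initialVertex U L)ᶜ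

/-- The exponent `ε(L ∪ A ⊗ L ∪ B)` of the sign of a term. -/
def signExponent {p : ℕ} (L A B : Finset (Fin (p + 1))) : ℕ :=
  ∑ b ∈ B, numBelow A b + ∑ l ∈ L, numBelow L l + (p + 1) * A.card

/-- The value `Δ_i^U(σ) = ∑_{|L| = i + 1} (-1)^ε σ|_{L ∪ A_L^U} ⊗ σ|_{L ∪ B_L^U}`. -/
def cubillageValue (i : ℕ) {p : ℕ} (U : Finset (Finset (Fin (p + 1))))
    (σ : SingularSimplex X p) : Chains X ⊗[ℤ] Chains X :=
  ∑ L ∈ Finset.powersetCard (i + 1) (Finset.univ : Finset (Fin (p + 1))),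
    (-1 : ℤ) ^ signExponent L (initialVertex U L) (coInitialVertex U L) •
      (faceChain σ (L ∪ initialVertex U L) ⊗ₜ[ℤ] faceChain σ (L ∪ coInitialVertex U L))

/-- The coproduct `Δ_i^∅` on singular chains, for `i ≥ 0`. -/
def deltaEmpty (X : Type*) [TopologicalSpace X] (i : ℕ) :
    Chains X →ₗ[ℤ] Chains X ⊗[ℤ] Chains X :=
  Finsupp.linearCombination ℤ fun s => cubillageValue i ∅ s.2

/-- The coproduct `Δ_{i-1}^∅`, with the convention `Δ_{-1}^∅ = 0`. -/
def deltaEmptyPred (X : Type*) [TopologicalSpace X] :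
    ℕ → (Chains X →ₗ[ℤ] Chains X ⊗[ℤ] Chains X)
  | 0 => 0
  | i + 1 => deltaEmpty X i

/-! ### Coproducts given by a formula that depends only on the dimension -/

/-- A formula for a degree `i` coproduct that depends only on the dimension of the simplex: for
each dimension `p`, an integral combination of pairs of faces `S ⊗ T` of the standard `p`-simplex
with `(|S| - 1) + (|T| - 1) = p + i`. As `|S|, |T| ≤ p + 1`, both faces are then non-empty. -/
structure Formula (i : ℕ) where
  coeff : ∀ p : ℕ, Finset (Fin (p + 1)) → Finset (Fin (p + 1)) → ℤ
  degree : ∀ (p : ℕ) (S T : Finset (Fin (p + 1))), coeff p S T ≠ 0 → S.card + T.card = p + i + 2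

/-- The value of a formula on a singular simplex. -/
def Formula.value {i : ℕ} (Φ : Formula i) {p : ℕ} (σ : SingularSimplex X p) :
    Chains X ⊗[ℤ] Chains X :=
  ∑ S : Finset (Fin (p + 1)), ∑ T : Finset (Fin (p + 1)),
    Φ.coeff p S T • (faceChain σ S ⊗ₜ[ℤ] faceChain σ T)

/-- The coproduct on singular chains of `X` given by a formula. -/
def Formula.coproduct {i : ℕ} (Φ : Formula i) (X : Type*) [TopologicalSpace X] :
    Chains X →ₗ[ℤ] Chains X ⊗[ℤ] Chains X :=
  Finsupp.linearCombination ℤ fun s => Φ.value s.2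

/-- The number of terms of a formula in dimension `p`. -/
def Formula.numTerms {i : ℕ} (Φ : Formula i) (p : ℕ) : ℕ :=
  (Finset.univ.filter fun ST : Finset (Fin (p + 1)) × Finset (Fin (p + 1)) =>
    Φ.coeff p ST.1 ST.2 ≠ 0).card

/-- The homotopy formula `∂ ∘ D - (-1)^i D ∘ ∂ = (1 + (-1)^i T) Δ_{i-1}^∅`. -/
def HomotopyFormula (i : ℕ) (D : Chains X →ₗ[ℤ] Chains X ⊗[ℤ] Chains X) : Prop :=
  tensorBoundary X ∘ₗ D - (-1 : ℤ) ^ i • (D ∘ₗ boundary X) =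
    (LinearMap.id + (-1 : ℤ) ^ i • swap X) ∘ₗ deltaEmptyPred X i

/-- For `i = 0`, the coproduct sends each `0`-simplex `σ` to `σ ⊗ σ`; no condition otherwise. -/
def Normalized (i : ℕ) (D : Chains X →ₗ[ℤ] Chains X ⊗[ℤ] Chains X) : Prop :=
  i = 0 → ∀ σ : SingularSimplex X 0, D (simplexChain σ) = simplexChain σ ⊗ₜ[ℤ] simplexChain σ

end CupCoproduct

end

/-!
Since `X` has a path with distinct end points, for any two faces that are not both vertices some
singular simplex of `X` distinguishes both of them from all other faces. Hence the difference of
two admissible formulas that agree in dimension `p - 1` is a formal cycle in dimension `p`. Modulo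
two, the coefficients of a cycle at the pairs `(S, T)` with `S ∪ T = [0, p]` and `S ∩ T = L` have
sum zero, for each non-empty `L`. As `Δ_i^∅` has exactly one term for each `L` with `i + 1`
elements, a formula with the minimal number of terms has exactly one term, with an odd coefficient,
for each such `L`.

The support of a cycle whose terms cover all vertices is closed under exchanging the roles of a
vertex outside `S ∩ T` in `S` and `T`. In dimensions above `i + 1` this produces three terms with
the same `L`, while the difference of two minimal formulas has at most two, so that the difference
vanishes. In dimension `i + 1` a cycle is zero once one of its coefficients is, which leaves the two
choices `Δ_i^∅` and its opposite.

For the homotopy formula of `Δ_i^∅`, the boundary terms at `L ∪ A_L ⊗ L ∪ B_L` that remove a vertex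
of `L` telescope for each `M` with `i` elements: as `l` runs through the vertices outside `M`, the
splitting `A_M`, `B_M` turns step by step into `B_M`, `A_M`.
-/

noncomputable section

namespace CupCoproduct

variable {X : Type*} [TopologicalSpace X]

/-! ### Sums over flags of vertex sets -/

section Flags

variable {V N : Type*} [Fintype V] [DecidableEq V] [AddCommMonoid N]

theorem sum_sdiff_eq_sum_compl (L : Finset V) (f : Finset V → V → N) :
    ∑ S ∈ Finset.Ici L, ∑ s ∈ S \ L, f S s =
      ∑ S ∈ Finset.Ici L, ∑ s ∈ Sᶜ, f (insert s S) s := by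
  rw [Finset.sum_sigma', Finset.sum_sigma']
  refine Finset.sum_bij' (fun x _ => ⟨x.1.erase x.2, x.2⟩) (fun x _ => ⟨insert x.2 x.1, x.2⟩)
    ?_ ?_ ?_ ?_ ?_
  · rintro ⟨S, s⟩ h
    simp only [Finset.mem_sigma, Finset.mem_Ici, Finset.mem_sdiff, Finset.mem_compl,
      Finset.notMem_erase, not_false_eq_true, and_true] at h ⊢
    exact Finset.subset_erase.mpr ⟨h.1, h.2.2⟩
  · rintro ⟨S, s⟩ h
    simp only [Finset.mem_sigma, Finset.mem_Ici, Finset.mem_sdiff, Finset.mem_compl,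
      Finset.mem_insert_self, true_and] at h ⊢
    exact ⟨h.1.trans (Finset.subset_insert s S), fun hs => h.2 (h.1 hs)⟩
  · rintro ⟨S, s⟩ h
    simp only [Finset.mem_sigma, Finset.mem_sdiff] at h
    simp [Finset.insert_erase h.2.1]
  · rintro ⟨S, s⟩ h
    simp only [Finset.mem_sigma, Finset.mem_compl] at h
    simp [Finset.erase_insert h.2]
  · rintro ⟨S, s⟩ h
    simp only [Finset.mem_sigma, Finset.mem_sdiff] at h
    simp [Finset.insert_erase h.2.1]

theorem sum_sum_mem_eq_sum_compl (f : Finset V → V → N) :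
    ∑ S, ∑ s ∈ S, f S s = ∑ S, ∑ s ∈ Sᶜ, f (insert s S) s := by
  simpa [Finset.Ici_bot (α := Finset V), ← Finset.bot_eq_empty] using sum_sdiff_eq_sum_compl ∅ f

theorem sum_powersetCard_succ (i : ℕ) (f : Finset V → V → N) :
    ∑ L ∈ Finset.powersetCard (i + 1) Finset.univ, ∑ l ∈ L, f L l =
      ∑ M ∈ Finset.powersetCard i Finset.univ, ∑ l ∈ Mᶜ, f (insert l M) l := by
  have h := sum_sum_mem_eq_sum_compl fun L l => if L.card = i + 1 then f L l else 0
  simp only [Finset.sum_ite_irrel, Finset.sum_const_zero] at h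
  rw [← Finset.sum_filter] at h
  simp only [Finset.powersetCard_eq_filter, Finset.powerset_univ]
  rw [h, Finset.sum_filter]
  refine Finset.sum_congr rfl fun M _ => ?_
  rw [← Finset.sum_const_zero (s := Mᶜ), ← Finset.sum_ite_irrel]
  refine Finset.sum_congr rfl fun l hl => ?_
  simp [Finset.card_insert_of_notMem (Finset.mem_compl.mp hl)]

end Flags

/-! ### Signs -/

section Counting

variable {p : ℕ}

theorem numBelow_map {q : ℕ} (e : Fin (q + 1) ↪o Fin (p + 1)) (L : Finset (Fin (q + 1)))
    (a : Fin (q + 1)) : numBelow (L.map e.toEmbedding) (e a) = numBelow L a := by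
  simp [numBelow, Finset.filter_map]

theorem numAbove_map {q : ℕ} (e : Fin (q + 1) ↪o Fin (p + 1)) (L : Finset (Fin (q + 1)))
    (a : Fin (q + 1)) : numAbove (L.map e.toEmbedding) (e a) = numAbove L a := by
  simp [numAbove, Finset.filter_map]

theorem numBelow_univ (a : Fin (p + 1)) : numBelow Finset.univ a = a := by
  rw [numBelow, Finset.filter_gt_eq_Iio, Fin.card_Iio]

theorem numBelow_insert {L : Finset (Fin (p + 1))} {l : Fin (p + 1)} (hl : l ∉ L)
    (a : Fin (p + 1)) : numBelow (insert l L) a = numBelow L a + if l < a then 1 else 0 := by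
  simp only [numBelow, Finset.card_filter, Finset.sum_insert hl, add_comm]

theorem numAbove_insert {L : Finset (Fin (p + 1))} {l : Fin (p + 1)} (hl : l ∉ L)
    (a : Fin (p + 1)) : numAbove (insert l L) a = numAbove L a + if a < l then 1 else 0 := by
  simp only [numAbove, Finset.card_filter, Finset.sum_insert hl, add_comm]

theorem numBelow_insert_self (L : Finset (Fin (p + 1))) (a : Fin (p + 1)) :
    numBelow (insert a L) a = numBelow L a := by
  simp [numBelow, Finset.filter_insert]

theorem numAbove_insert_self (L : Finset (Fin (p + 1))) (a : Fin (p + 1)) :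
    numAbove (insert a L) a = numAbove L a := by
  simp [numAbove, Finset.filter_insert]

theorem numBelow_union {L M : Finset (Fin (p + 1))} (h : Disjoint L M) (a : Fin (p + 1)) :
    numBelow (L ∪ M) a = numBelow L a + numBelow M a := by
  simp only [numBelow, Finset.card_filter, Finset.sum_union h]

theorem numBelow_add_numAbove {L : Finset (Fin (p + 1))} {a : Fin (p + 1)} (ha : a ∉ L) :
    numBelow L a + numAbove L a = L.card := by
  have hne : ∀ l ∈ L, ¬ l < a ↔ a < l := fun l hl =>
    ⟨fun h => (not_lt.mp h).lt_of_ne fun he => ha (he ▸ hl), fun h => h.asymm⟩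
  rw [numBelow, numAbove, ← Finset.filter_congr hne, Finset.card_filter_add_card_filter_not]

theorem odd_numAbove_insert {L : Finset (Fin (p + 1))} {l : Fin (p + 1)} (hl : l ∉ L)
    (a : Fin (p + 1)) :
    Odd (numAbove (insert l L) a) ↔ Xor (Odd (numAbove L a)) (a < l) := by
  rw [numAbove_insert hl]
  split_ifs with h <;> simp [h, Xor, Nat.odd_add_one]

/-- The number of pairs `a < b` with `a ∈ A` and `b ∈ B`. -/
def numPairsLT (A B : Finset (Fin (p + 1))) : ℕ :=
  ∑ b ∈ B, numBelow A b

theorem numPairsLT_map {q : ℕ} (e : Fin (q + 1) ↪o Fin (p + 1)) (A B : Finset (Fin (q + 1))) :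
    numPairsLT (A.map e.toEmbedding) (B.map e.toEmbedding) = numPairsLT A B := by
  simp only [numPairsLT, Finset.sum_map]
  exact Finset.sum_congr rfl fun b _ => numBelow_map e A b

theorem numPairsLT_insert_left {A : Finset (Fin (p + 1))} {l : Fin (p + 1)} (hl : l ∉ A)
    (B : Finset (Fin (p + 1))) : numPairsLT (insert l A) B = numPairsLT A B + numAbove B l := by
  simp [numPairsLT, numBelow_insert hl, Finset.sum_add_distrib, numAbove]

theorem numPairsLT_insert_right (A : Finset (Fin (p + 1))) {B : Finset (Fin (p + 1))}
    {l : Fin (p + 1)} (hl : l ∉ B) : numPairsLT A (insert l B) = numBelow A l + numPairsLT A B :=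
  Finset.sum_insert hl

theorem numPairsLT_insert_self {M : Finset (Fin (p + 1))} {l : Fin (p + 1)} (hl : l ∉ M) :
    numPairsLT (insert l M) (insert l M) = numPairsLT M M + M.card := by
  rw [numPairsLT_insert_right _ hl, numPairsLT_insert_left hl, numBelow_insert_self,
    ← numBelow_add_numAbove hl]
  ring

theorem numPairsLT_add_numPairsLT {A B : Finset (Fin (p + 1))} (h : Disjoint A B) :
    numPairsLT A B + numPairsLT B A = A.card * B.card := by
  have hBA : numPairsLT B A = ∑ b ∈ B, numAbove A b := by
    simp only [numPairsLT, numBelow, numAbove, Finset.card_filter]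
    exact Finset.sum_comm
  rw [hBA, numPairsLT, ← Finset.sum_add_distrib, Finset.sum_congr rfl fun b hb =>
    numBelow_add_numAbove (Finset.disjoint_right.mp h hb)]
  simp [mul_comm]

end Counting

/-- The vertex set is the disjoint union of `L`, `A` and `B`; such a splitting encodes the pair of
faces `L ∪ A`, `L ∪ B`, which cover all vertices and have intersection `L`. -/
structure IsSplitting {V : Type*} [Fintype V] [DecidableEq V] (L A B : Finset V) : Prop where
  disjoint_left : Disjoint L A
  disjoint_right : Disjoint L B
  disjoint : Disjoint A B
  union_eq : L ∪ A ∪ B = Finset.univ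

namespace IsSplitting

section

variable {V : Type*} [Fintype V] [DecidableEq V] {L A B : Finset V}

theorem of_compl (h : Disjoint L A) : IsSplitting L A (L ∪ A)ᶜ where
  disjoint_left := h
  disjoint_right := disjoint_compl_right.mono_left Finset.subset_union_left
  disjoint := disjoint_compl_right.mono_left Finset.subset_union_right
  union_eq := Finset.union_compl _

theorem symm (h : IsSplitting L A B) : IsSplitting L B A where
  disjoint_left := h.disjoint_right
  disjoint_right := h.disjoint_left
  disjoint := h.disjoint.symm
  union_eq := by rw [Finset.union_right_comm, h.union_eq]

theorem compl_union (h : IsSplitting L A B) : (L ∪ A)ᶜ = B :=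
  (isCompl_iff.mpr ⟨Finset.disjoint_union_left.mpr ⟨h.disjoint_right, h.disjoint⟩,
    codisjoint_iff.mpr h.union_eq⟩).compl_eq

theorem union_union_union (h : IsSplitting L A B) : L ∪ A ∪ (L ∪ B) = Finset.univ := by
  rw [← Finset.union_union_distrib_left, ← Finset.union_assoc, h.union_eq]

theorem union_inter_union (h : IsSplitting L A B) : (L ∪ A) ∩ (L ∪ B) = L := by
  rw [← Finset.union_inter_distrib_left, Finset.disjoint_iff_inter_eq_empty.mp h.disjoint,
    Finset.union_empty]

theorem card_add_card_add_card (h : IsSplitting L A B) :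
    L.card + A.card + B.card = Fintype.card V := by
  rw [← Finset.card_union_of_disjoint h.disjoint_left, ← Finset.card_union_of_disjoint
    (Finset.disjoint_union_left.mpr ⟨h.disjoint_right, h.disjoint⟩), h.union_eq, Finset.card_univ]

end

variable {p : ℕ} {L A B : Finset (Fin (p + 1))}

theorem numBelow_add_numBelow_add_numBelow (h : IsSplitting L A B) (j : Fin (p + 1)) :
    numBelow L j + numBelow A j + numBelow B j = j := by
  rw [← numBelow_union h.disjoint_left, ← numBelow_union
    (Finset.disjoint_union_left.mpr ⟨h.disjoint_right, h.disjoint⟩), h.union_eq, numBelow_univ]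

end IsSplitting

/-- The sign exponent of the term given by `L`, `A`, `B` on a face with `n` vertices; on the whole
`p`-simplex, where `n = p + 1`, it is `signExponent L A B`. -/
def relSignExponent {p : ℕ} (n : ℕ) (L A B : Finset (Fin (p + 1))) : ℕ :=
  numPairsLT A B + numPairsLT L L + n * A.card

theorem relSignExponent_map {p q : ℕ} (n : ℕ) (e : Fin (q + 1) ↪o Fin (p + 1))
    (L A B : Finset (Fin (q + 1))) :
    relSignExponent n (L.map e.toEmbedding) (A.map e.toEmbedding) (B.map e.toEmbedding) =
      relSignExponent n L A B := by
  simp only [relSignExponent, numPairsLT_map, Finset.card_map]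

section SignExponents

variable {p : ℕ} {L A B : Finset (Fin (p + 1))} {j : Fin (p + 1)}

theorem relSignExponent_erase_left (h : IsSplitting L A B) (hj : j ∈ A) :
    relSignExponent (p + 1) L A B + numBelow (L ∪ A) j ≡
      L.card + 1 + j + relSignExponent p L (A.erase j) B [MOD 2] := by
  have hcard := h.card_add_card_add_card
  have hbelow := h.numBelow_add_numBelow_add_numBelow j
  have hB := numBelow_add_numAbove (Finset.disjoint_left.mp h.disjoint hj)
  have hdisj := h.disjoint_left
  obtain ⟨A', hjA', rfl⟩ : ∃ A', j ∉ A' ∧ insert j A' = A :=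
    ⟨A.erase j, Finset.notMem_erase j A, Finset.insert_erase hj⟩
  rw [numBelow_insert_self] at hbelow
  rw [Finset.card_insert_of_notMem hjA', Fintype.card_fin] at hcard
  rw [numBelow_union hdisj, Finset.erase_insert hjA', relSignExponent, relSignExponent,
    numPairsLT_insert_left hjA', numBelow_insert_self, Finset.card_insert_of_notMem hjA',
    show (p + 1) * (A'.card + 1) = p * A'.card + p + A'.card + 1 by ring, Nat.ModEq]
  omega

theorem relSignExponent_erase_right (h : IsSplitting L A B) (hL : L.Nonempty) (hj : j ∈ B) :
    relSignExponent (p + 1) L A B + ((L ∪ A).card - 1 + numBelow (L ∪ B) j) ≡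
      L.card + 1 + j + relSignExponent p L A (B.erase j) [MOD 2] := by
  have hbelow := h.numBelow_add_numBelow_add_numBelow j
  have hpairs := numPairsLT_insert_right A (Finset.notMem_erase j B)
  rw [Finset.insert_erase hj] at hpairs
  have hLpos := hL.card_pos
  rw [numBelow_union h.disjoint_right, Finset.card_union_of_disjoint h.disjoint_left,
    relSignExponent, relSignExponent, hpairs, add_one_mul, Nat.ModEq]
  omega

theorem relSignExponent_facet_left (h : IsSplitting L A B) (hj : j ∈ L) :
    relSignExponent (p + 1) L A B + numBelow (L ∪ A) j ≡
      numAbove L j + relSignExponent (p + 1) (L.erase j) A (insert j B) [MOD 2] := by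
  have hjB := Finset.disjoint_left.mp h.disjoint_right hj
  have hdisj := h.disjoint_left
  obtain ⟨M, hjM, rfl⟩ : ∃ M, j ∉ M ∧ insert j M = L :=
    ⟨L.erase j, Finset.notMem_erase j L, Finset.insert_erase hj⟩
  have hM := numBelow_add_numAbove hjM
  rw [numBelow_union hdisj, relSignExponent, relSignExponent, numPairsLT_insert_right A hjB,
    numPairsLT_insert_self hjM, numBelow_insert_self, numAbove_insert_self,
    Finset.erase_insert hjM, Nat.ModEq]
  omega

theorem relSignExponent_facet_right (h : IsSplitting L A B) (hj : j ∈ L) :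
    relSignExponent (p + 1) L A B + ((L ∪ A).card - 1 + numBelow (L ∪ B) j) ≡
      numAbove L j + 1 + relSignExponent (p + 1) (L.erase j) (insert j A) B [MOD 2] := by
  have hjA := Finset.disjoint_left.mp h.disjoint_left hj
  have hB := numBelow_add_numAbove (Finset.disjoint_left.mp h.disjoint_right hj)
  have hcard := h.card_add_card_add_card
  rw [Fintype.card_fin] at hcard
  have hLA := h.disjoint_left
  have hLB := h.disjoint_right
  obtain ⟨M, hjM, rfl⟩ : ∃ M, j ∉ M ∧ insert j M = L :=
    ⟨L.erase j, Finset.notMem_erase j L, Finset.insert_erase hj⟩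
  have hM := numBelow_add_numAbove hjM
  rw [Finset.card_insert_of_notMem hjM] at hcard
  rw [numBelow_union hLB, Finset.card_union_of_disjoint hLA, relSignExponent, relSignExponent,
    numPairsLT_insert_left hjA, numPairsLT_insert_self hjM, numBelow_insert_self,
    numAbove_insert_self, Finset.erase_insert hjM, Finset.card_insert_of_notMem hjM,
    Finset.card_insert_of_notMem hjA, mul_add_one, Nat.ModEq]
  omega

theorem relSignExponent_swap (h : IsSplitting L A B) (hL : L.Nonempty) :
    relSignExponent (p + 1) L A B + ((L ∪ A).card - 1) * ((L ∪ B).card - 1) ≡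
      L.card + 1 + relSignExponent (p + 1) L B A [MOD 2] := by
  have hpairs := numPairsLT_add_numPairsLT h.disjoint
  have hcard := h.card_add_card_add_card
  obtain ⟨m, hm⟩ : ∃ m, L.card = m + 1 := Nat.exists_eq_add_of_le' hL.card_pos
  rw [Finset.card_union_of_disjoint h.disjoint_left, Finset.card_union_of_disjoint h.disjoint_right]
  rw [Fintype.card_fin, hm] at hcard
  rw [relSignExponent, relSignExponent, hm, Nat.add_right_comm m 1, Nat.add_right_comm m 1,
    Nat.add_sub_cancel, Nat.add_sub_cancel, ← ZMod.natCast_eq_natCast_iff]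
  have hsq (n : ZMod 2) : n * n = n := by fin_cases n <;> rfl
  have hm_sq := hsq m
  have hA_sq := hsq A.card
  have hB_sq := hsq B.card
  replace hpairs := congrArg (Nat.cast (R := ZMod 2)) hpairs
  replace hcard := congrArg (Nat.cast (R := ZMod 2)) hcard
  push_cast at hpairs hcard ⊢
  grind

end SignExponents

theorem neg_one_pow_congr_of_modEq {R : Type*} [Monoid R] [HasDistribNeg R] {a b : ℕ}
    (h : a ≡ b [MOD 2]) : (-1 : R) ^ a = (-1) ^ b :=
  neg_one_pow_congr (by rw [Nat.even_iff, Nat.even_iff, h])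

/-! ### Faces and chain maps -/

section Faces

variable {p q : ℕ}

theorem map_vertexMap_univ (S : Finset (Fin (p + 1))) (hS : S.Nonempty) :
    (Finset.univ : Finset (Fin (S.card - 1 + 1))).map (vertexMap S hS).toEmbedding = S := by
  simp [vertexMap, Finset.map_orderEmbOfFin_univ]

theorem numBelow_vertexMap (S : Finset (Fin (p + 1))) (hS : S.Nonempty)
    (j : Fin (S.card - 1 + 1)) : numBelow S (vertexMap S hS j) = j := by
  have h := numBelow_map (vertexMap S hS) Finset.univ j
  rwa [map_vertexMap_univ, numBelow_univ] at h

@[simp] theorem faceChain_empty (σ : SingularSimplex X p) : faceChain σ ∅ = 0 := by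
  simp [faceChain]

theorem faceChain_of_nonempty (σ : SingularSimplex X p) {S : Finset (Fin (p + 1))}
    (hS : S.Nonempty) : faceChain σ S = simplexChain (face σ S hS) := by
  simp [faceChain, hS]

theorem faceChain_eq_of_orderEmbedding {k : ℕ} (σ : SingularSimplex X p)
    (S : Finset (Fin (p + 1))) (e : Fin (k + 1) ↪o Fin (p + 1))
    (he : Finset.univ.map e.toEmbedding = S) :
    faceChain σ S = simplexChain (σ.comp ⟨stdSimplex.map e, stdSimplex.continuous_map _⟩) := by
  have hcard : S.card = k + 1 := by simp [← he]
  have hS : S.Nonempty := Finset.card_pos.mp (by omega)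
  obtain rfl : k = S.card - 1 := by omega
  obtain rfl : e = vertexMap S hS := by
    refine Finset.orderEmbOfFin_unique' _ fun x => ?_
    exact he.subset (Finset.mem_map_of_mem e.toEmbedding (Finset.mem_univ x))
  exact faceChain_of_nonempty σ hS

theorem faceChain_face (σ : SingularSimplex X p) (S : Finset (Fin (p + 1))) (hS : S.Nonempty)
    (U : Finset (Fin (S.card - 1 + 1))) :
    faceChain (face σ S hS) U = faceChain σ (U.map (vertexMap S hS).toEmbedding) := by
  rcases U.eq_empty_or_nonempty with rfl | hU
  · simp
  · rw [faceChain_of_nonempty _ hU, faceChain_eq_of_orderEmbedding σ _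
      ((vertexMap U hU).trans (vertexMap S hS))]
    · congr 1
      ext x
      simp only [face, ContinuousMap.comp_apply, ContinuousMap.coe_mk]
      rw [stdSimplex.map_comp_apply]
      rfl
    · conv_rhs => rw [← map_vertexMap_univ U hU]
      rw [Finset.map_map]
      rfl

theorem faceChain_univ (σ : SingularSimplex X p) : faceChain σ Finset.univ = simplexChain σ := by
  rw [faceChain_eq_of_orderEmbedding σ _ (OrderIso.refl (Fin (p + 1))).toOrderEmbedding]
  · congr 1
    ext x
    simp
  · ext x; simp

theorem linearCombination_simplexChain {M : Type*} [AddCommMonoid M] [Module ℤ M]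
    (f : (Σ p : ℕ, SingularSimplex X p) → M) (σ : SingularSimplex X p) :
    Finsupp.linearCombination ℤ f (simplexChain σ) = f ⟨p, σ⟩ := by
  rw [simplexChain, Finsupp.linearCombination_single, one_smul]

theorem boundary_simplexChain (σ : SingularSimplex X p) :
    boundary X (simplexChain σ) =
      ∑ j : Fin (p + 1), (-1 : ℤ) ^ (j : ℕ) • faceChain σ (Finset.univ.erase j) :=
  linearCombination_simplexChain _ σ

theorem boundary_faceChain (σ : SingularSimplex X p) (S : Finset (Fin (p + 1))) :
    boundary X (faceChain σ S) = ∑ s ∈ S, (-1 : ℤ) ^ numBelow S s • faceChain σ (S.erase s) := by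
  rcases S.eq_empty_or_nonempty with rfl | hS
  · simp
  · rw [faceChain_of_nonempty σ hS, boundary_simplexChain]
    conv_rhs => rw [← map_vertexMap_univ S hS]
    rw [Finset.sum_map]
    refine Finset.sum_congr rfl fun j _ => ?_
    rw [faceChain_face, Finset.map_erase, map_vertexMap_univ]
    congr 2
    exact (numBelow_vertexMap S hS j).symm

theorem degreeSign_faceChain (σ : SingularSimplex X p) (S : Finset (Fin (p + 1))) :
    degreeSign X (faceChain σ S) = (-1 : ℤ) ^ (S.card - 1) • faceChain σ S := by
  rcases S.eq_empty_or_nonempty with rfl | hS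
  · simp
  · rw [faceChain_of_nonempty σ hS]
    exact linearCombination_simplexChain _ _

theorem swap_simplexChain (σ : SingularSimplex X p) (τ : SingularSimplex X q) :
    swap X (simplexChain σ ⊗ₜ[ℤ] simplexChain τ) =
      (-1 : ℤ) ^ (p * q) • (simplexChain τ ⊗ₜ[ℤ] simplexChain σ) := by
  rw [swap, TensorProduct.lift.tmul, linearCombination_simplexChain,
    linearCombination_simplexChain]

theorem swap_faceChain (σ : SingularSimplex X p) (τ : SingularSimplex X q)
    (S : Finset (Fin (p + 1))) (T : Finset (Fin (q + 1))) :
    swap X (faceChain σ S ⊗ₜ[ℤ] faceChain τ T) =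
      (-1 : ℤ) ^ ((S.card - 1) * (T.card - 1)) • (faceChain τ T ⊗ₜ[ℤ] faceChain σ S) := by
  rcases S.eq_empty_or_nonempty with rfl | hS
  · simp
  rcases T.eq_empty_or_nonempty with rfl | hT
  · simp
  rw [faceChain_of_nonempty σ hS, faceChain_of_nonempty τ hT, swap_simplexChain]

theorem tensorBoundary_faceChain (σ : SingularSimplex X p) (τ : SingularSimplex X q)
    (S : Finset (Fin (p + 1))) (T : Finset (Fin (q + 1))) :
    tensorBoundary X (faceChain σ S ⊗ₜ[ℤ] faceChain τ T) =
      ∑ s ∈ S, (-1 : ℤ) ^ numBelow S s • (faceChain σ (S.erase s) ⊗ₜ[ℤ] faceChain τ T) +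
      ∑ t ∈ T, (-1 : ℤ) ^ (S.card - 1 + numBelow T t) •
        (faceChain σ S ⊗ₜ[ℤ] faceChain τ (T.erase t)) := by
  rw [tensorBoundary, LinearMap.add_apply, TensorProduct.map_tmul, TensorProduct.map_tmul,
    boundary_faceChain, boundary_faceChain, degreeSign_faceChain, TensorProduct.sum_tmul,
    TensorProduct.tmul_sum]
  congr 1
  refine Finset.sum_congr rfl fun t _ => ?_
  rw [TensorProduct.smul_tmul_smul, pow_add]

theorem chains_hom_ext {M : Type*} [AddCommMonoid M] [Module ℤ M] {f g : Chains X →ₗ[ℤ] M}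
    (h : ∀ (p : ℕ) (σ : SingularSimplex X p), f (simplexChain σ) = g (simplexChain σ)) :
    f = g := by
  refine Finsupp.lhom_ext' fun s => ?_
  ext
  exact h s.1 s.2

theorem chains_tensor_hom_ext {M : Type*} [AddCommMonoid M] [Module ℤ M]
    {f g : Chains X ⊗[ℤ] Chains X →ₗ[ℤ] M}
    (h : ∀ (p q : ℕ) (σ : SingularSimplex X p) (τ : SingularSimplex X q),
      f (simplexChain σ ⊗ₜ[ℤ] simplexChain τ) = g (simplexChain σ ⊗ₜ[ℤ] simplexChain τ)) :
    f = g :=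
  TensorProduct.ext <| chains_hom_ext fun p σ => chains_hom_ext fun q τ => h p q σ τ

end Faces

/-! ### The opposite coproduct -/

section Swap

variable {p q : ℕ}

theorem swap_comp_swap : swap X ∘ₗ swap X = LinearMap.id := by
  refine chains_tensor_hom_ext fun p q σ τ => ?_
  rw [LinearMap.comp_apply, LinearMap.id_apply, swap_simplexChain, map_smul, swap_simplexChain,
    smul_smul, mul_comm q, pow_mul_pow_eq_one _ (by norm_num), one_smul]

theorem swap_swap (x : Chains X ⊗[ℤ] Chains X) : swap X (swap X x) = x :=
  LinearMap.congr_fun swap_comp_swap x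

theorem swap_boundary_tmul (σ : SingularSimplex X p) (τ : SingularSimplex X q) :
    swap X (boundary X (simplexChain σ) ⊗ₜ[ℤ] simplexChain τ) =
      (-1 : ℤ) ^ ((p + 1) * q) • (simplexChain τ ⊗ₜ[ℤ] boundary X (simplexChain σ)) := by
  rw [boundary_simplexChain, TensorProduct.sum_tmul, map_sum, TensorProduct.tmul_sum,
    Finset.smul_sum]
  refine Finset.sum_congr rfl fun j _ => ?_
  rw [← TensorProduct.smul_tmul', map_smul, TensorProduct.tmul_smul, smul_comm]
  congr 1
  rcases p with _ | p
  · simp [Fin.fin_one_eq_zero j]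
  · rw [← faceChain_univ τ, swap_faceChain]
    congr 1
    refine neg_one_pow_congr_of_modEq ?_
    rw [Finset.card_erase_of_mem (Finset.mem_univ j), Finset.card_fin, Finset.card_fin,
      Nat.ModEq]
    simp only [Nat.add_sub_cancel, add_mul]
    omega

theorem swap_tmul_boundary (σ : SingularSimplex X p) (τ : SingularSimplex X q) :
    swap X (simplexChain σ ⊗ₜ[ℤ] boundary X (simplexChain τ)) =
      (-1 : ℤ) ^ (p * (q + 1)) • (boundary X (simplexChain τ) ⊗ₜ[ℤ] simplexChain σ) := by
  have h := congrArg (swap X) (swap_boundary_tmul τ σ)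
  rw [swap_swap, map_smul] at h
  rw [h, mul_comm p, smul_smul, pow_mul_pow_eq_one _ (by norm_num), one_smul]

theorem tensorBoundary_comp_swap : tensorBoundary X ∘ₗ swap X = swap X ∘ₗ tensorBoundary X := by
  refine chains_tensor_hom_ext fun p q σ τ => ?_
  have hboundary {m n : ℕ} (υ : SingularSimplex X m) (ω : SingularSimplex X n) :
      tensorBoundary X (simplexChain υ ⊗ₜ[ℤ] simplexChain ω) =
        boundary X (simplexChain υ) ⊗ₜ[ℤ] simplexChain ω +
          (-1 : ℤ) ^ m • (simplexChain υ ⊗ₜ[ℤ] boundary X (simplexChain ω)) := by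
    rw [tensorBoundary, LinearMap.add_apply, TensorProduct.map_tmul, TensorProduct.map_tmul,
      degreeSign, linearCombination_simplexChain, LinearMap.id_apply, TensorProduct.smul_tmul']
  rw [LinearMap.comp_apply, LinearMap.comp_apply, swap_simplexChain, map_smul, hboundary,
    hboundary, map_add, map_smul, swap_boundary_tmul, swap_tmul_boundary, smul_add, smul_smul,
    smul_smul, ← pow_add, ← pow_add, add_comm]
  congr 2 <;> exact neg_one_pow_congr_of_modEq (by grind [Nat.ModEq])

end Swap

theorem homotopyFormula_iff {i : ℕ} {D : Chains X →ₗ[ℤ] Chains X ⊗[ℤ] Chains X} :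
    HomotopyFormula i D ↔ ∀ x, tensorBoundary X (D x) - (-1 : ℤ) ^ i • D (boundary X x) =
      deltaEmptyPred X i x + (-1 : ℤ) ^ i • swap X (deltaEmptyPred X i x) :=
  LinearMap.ext_iff

theorem HomotopyFormula.opposite {i : ℕ} {D : Chains X →ₗ[ℤ] Chains X ⊗[ℤ] Chains X}
    (h : HomotopyFormula i D) : HomotopyFormula i ((-1 : ℤ) ^ i • (swap X ∘ₗ D)) := by
  rw [homotopyFormula_iff] at h ⊢
  intro x
  have hsq : (-1 : ℤ) ^ i * (-1 : ℤ) ^ i = 1 := pow_mul_pow_eq_one i (by norm_num)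
  have hcomm : tensorBoundary X (swap X (D x)) = swap X (tensorBoundary X (D x)) :=
    LinearMap.congr_fun tensorBoundary_comp_swap (D x)
  have hx := congrArg ((-1 : ℤ) ^ i • swap X ·) (h x)
  rw [map_sub, map_add, map_smul, map_smul, swap_swap, smul_sub, smul_add, smul_smul _ _
    (deltaEmptyPred X i x), hsq, one_smul, add_comm (_ • _)] at hx
  rw [LinearMap.smul_apply, LinearMap.smul_apply, LinearMap.comp_apply, LinearMap.comp_apply,
    map_smul, hcomm, hx]

theorem Normalized.opposite {i : ℕ} {D : Chains X →ₗ[ℤ] Chains X ⊗[ℤ] Chains X}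
    (h : Normalized i D) : Normalized i ((-1 : ℤ) ^ i • (swap X ∘ₗ D)) := by
  rintro rfl σ
  rw [pow_zero, one_smul, LinearMap.comp_apply, h rfl, swap_simplexChain]
  exact one_smul ℤ _

/-! ### The homotopy formula for `Δ_i^∅` -/

section InitialVertex

variable {p q : ℕ} {L : Finset (Fin (p + 1))} {a : Fin (p + 1)}

theorem mem_initialVertex_empty : a ∈ initialVertex ∅ L ↔ a ∉ L ∧ Odd (numAbove L a) := by
  simp [initialVertex]

theorem mem_coInitialVertex_empty : a ∈ coInitialVertex ∅ L ↔ a ∉ L ∧ ¬ Odd (numAbove L a) := by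
  simp only [coInitialVertex, Finset.mem_compl, Finset.mem_union, mem_initialVertex_empty]
  tauto

theorem isSplitting_initialVertex (L : Finset (Fin (p + 1))) :
    IsSplitting L (initialVertex ∅ L) (coInitialVertex ∅ L) :=
  .of_compl <| Finset.disjoint_right.mpr fun _ ha => (mem_initialVertex_empty.mp ha).1

theorem map_eq_inter_map_univ {α β : Type*} [Fintype α] [DecidableEq β] (e : α ↪ β)
    {s : Finset α} {t : Finset β} (h : ∀ a, e a ∈ t ↔ a ∈ s) :
    s.map e = t ∩ Finset.univ.map e := by
  ext b
  simp only [Finset.mem_inter, Finset.mem_map, Finset.mem_univ, true_and]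
  constructor
  · rintro ⟨a, ha, rfl⟩
    exact ⟨(h a).mpr ha, a, rfl⟩
  · rintro ⟨hb, a, rfl⟩
    exact ⟨a, (h a).mp hb, rfl⟩

theorem initialVertex_map (e : Fin (q + 1) ↪o Fin (p + 1)) (L : Finset (Fin (q + 1))) :
    (initialVertex ∅ L).map e.toEmbedding =
      initialVertex ∅ (L.map e.toEmbedding) ∩ Finset.univ.map e.toEmbedding :=
  map_eq_inter_map_univ _ fun a => by simp [mem_initialVertex_empty, numAbove_map]

theorem coInitialVertex_map (e : Fin (q + 1) ↪o Fin (p + 1)) (L : Finset (Fin (q + 1))) :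
    (coInitialVertex ∅ L).map e.toEmbedding =
      coInitialVertex ∅ (L.map e.toEmbedding) ∩ Finset.univ.map e.toEmbedding :=
  map_eq_inter_map_univ _ fun a => by simp [mem_coInitialVertex_empty, numAbove_map]

end InitialVertex

section DeltaEmpty

variable {p : ℕ} (σ : SingularSimplex X p)

/-- The signed pair of faces `(-1)^ε σ|_{L ∪ A} ⊗ σ|_{L ∪ B}` inside a face with `n` vertices. -/
def signedTerm (n : ℕ) (L A B : Finset (Fin (p + 1))) : Chains X ⊗[ℤ] Chains X :=
  (-1 : ℤ) ^ relSignExponent n L A B • (faceChain σ (L ∪ A) ⊗ₜ[ℤ] faceChain σ (L ∪ B))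

theorem signedTerm_face (n : ℕ) (S : Finset (Fin (p + 1))) (hS : S.Nonempty)
    (L A B : Finset (Fin (S.card - 1 + 1))) :
    signedTerm (face σ S hS) n L A B = signedTerm σ n (L.map (vertexMap S hS).toEmbedding)
      (A.map (vertexMap S hS).toEmbedding) (B.map (vertexMap S hS).toEmbedding) := by
  rw [signedTerm, signedTerm, relSignExponent_map, faceChain_face, faceChain_face,
    Finset.map_union, Finset.map_union]

theorem deltaEmpty_simplexChain (i : ℕ) :
    deltaEmpty X i (simplexChain σ) = ∑ L ∈ Finset.powersetCard (i + 1) Finset.univ,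
      signedTerm σ (p + 1) L (initialVertex ∅ L) (coInitialVertex ∅ L) :=
  linearCombination_simplexChain _ σ

theorem deltaEmpty_faceChain (i : ℕ) (S : Finset (Fin (p + 1))) :
    deltaEmpty X i (faceChain σ S) = ∑ L ∈ Finset.powersetCard (i + 1) S,
      signedTerm σ S.card L (initialVertex ∅ L ∩ S) (coInitialVertex ∅ L ∩ S) := by
  rcases S.eq_empty_or_nonempty with rfl | hS
  · rw [Finset.powersetCard_eq_empty.mpr (by simp)]
    simp
  have hpowerset : Finset.powersetCard (i + 1) S =
      (Finset.powersetCard (i + 1) Finset.univ).map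
        (Finset.mapEmbedding (vertexMap S hS).toEmbedding).toEmbedding := by
    rw [← Finset.powersetCard_map, map_vertexMap_univ]
  rw [faceChain_of_nonempty σ hS, deltaEmpty_simplexChain, hpowerset, Finset.sum_map]
  refine Finset.sum_congr rfl fun L _ => ?_
  have hA := initialVertex_map (vertexMap S hS) L
  have hB := coInitialVertex_map (vertexMap S hS) L
  rw [map_vertexMap_univ] at hA hB
  rw [RelEmbedding.coe_toEmbedding, Finset.mapEmbedding_apply, signedTerm_face, hA, hB]
  congr 1
  exact Nat.sub_add_cancel hS.card_pos

section Splitting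

variable {L A B : Finset (Fin (p + 1))} {j : Fin (p + 1)}

theorem signedTerm_erase_left (h : IsSplitting L A B) (hj : j ∈ A) :
    (-1 : ℤ) ^ relSignExponent (p + 1) L A B • (-1 : ℤ) ^ numBelow (L ∪ A) j •
        (faceChain σ ((L ∪ A).erase j) ⊗ₜ[ℤ] faceChain σ (L ∪ B)) =
      (-1 : ℤ) ^ (L.card + 1) • (-1 : ℤ) ^ (j : ℕ) •
        signedTerm σ p L (A.erase j) (B.erase j) := by
  rw [signedTerm, Finset.erase_union_distrib,
    Finset.erase_eq_of_notMem (Finset.disjoint_right.mp h.disjoint_left hj),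
    Finset.erase_eq_of_notMem (Finset.disjoint_left.mp h.disjoint hj), smul_smul, smul_smul,
    smul_smul, ← pow_add, ← pow_add, ← pow_add,
    neg_one_pow_congr_of_modEq (relSignExponent_erase_left h hj), add_assoc]

theorem signedTerm_erase_right (h : IsSplitting L A B) (hL : L.Nonempty) (hj : j ∈ B) :
    (-1 : ℤ) ^ relSignExponent (p + 1) L A B •
        (-1 : ℤ) ^ ((L ∪ A).card - 1 + numBelow (L ∪ B) j) •
          (faceChain σ (L ∪ A) ⊗ₜ[ℤ] faceChain σ ((L ∪ B).erase j)) =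
      (-1 : ℤ) ^ (L.card + 1) • (-1 : ℤ) ^ (j : ℕ) •
        signedTerm σ p L (A.erase j) (B.erase j) := by
  rw [signedTerm, Finset.erase_union_distrib,
    Finset.erase_eq_of_notMem (Finset.disjoint_right.mp h.disjoint_right hj),
    Finset.erase_eq_of_notMem (Finset.disjoint_right.mp h.disjoint hj), smul_smul, smul_smul,
    smul_smul, ← pow_add, ← pow_add, ← pow_add,
    neg_one_pow_congr_of_modEq (relSignExponent_erase_right h hL hj), add_assoc]

theorem signedTerm_facet_left (h : IsSplitting L A B) (hj : j ∈ L) :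
    (-1 : ℤ) ^ relSignExponent (p + 1) L A B • (-1 : ℤ) ^ numBelow (L ∪ A) j •
        (faceChain σ ((L ∪ A).erase j) ⊗ₜ[ℤ] faceChain σ (L ∪ B)) =
      (-1 : ℤ) ^ numAbove L j • signedTerm σ (p + 1) (L.erase j) A (insert j B) := by
  rw [signedTerm, Finset.erase_union_distrib,
    Finset.erase_eq_of_notMem (Finset.disjoint_left.mp h.disjoint_left hj),
    ← Finset.insert_union_comm, Finset.insert_erase hj, smul_smul, smul_smul, ← pow_add,
    ← pow_add, neg_one_pow_congr_of_modEq (relSignExponent_facet_left h hj)]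

theorem signedTerm_facet_right (h : IsSplitting L A B) (hj : j ∈ L) :
    (-1 : ℤ) ^ relSignExponent (p + 1) L A B •
        (-1 : ℤ) ^ ((L ∪ A).card - 1 + numBelow (L ∪ B) j) •
          (faceChain σ (L ∪ A) ⊗ₜ[ℤ] faceChain σ ((L ∪ B).erase j)) =
      -((-1 : ℤ) ^ numAbove L j • signedTerm σ (p + 1) (L.erase j) (insert j A) B) := by
  rw [signedTerm, Finset.erase_union_distrib,
    Finset.erase_eq_of_notMem (Finset.disjoint_left.mp h.disjoint_right hj),
    ← Finset.insert_union_comm, Finset.insert_erase hj, smul_smul, smul_smul, ← pow_add,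
    ← pow_add, neg_one_pow_congr_of_modEq (relSignExponent_facet_right h hj),
    Nat.add_right_comm, pow_succ, mul_neg_one]
  exact neg_smul ((-1 : ℤ) ^ _) (_ : Chains X ⊗[ℤ] Chains X)

theorem tensorBoundary_signedTerm (h : IsSplitting L A B) (hL : L.Nonempty) :
    tensorBoundary X (signedTerm σ (p + 1) L A B) =
      (-1 : ℤ) ^ (L.card + 1) •
        ∑ j ∈ A ∪ B, (-1 : ℤ) ^ (j : ℕ) • signedTerm σ p L (A.erase j) (B.erase j) +
      ∑ l ∈ L, (-1 : ℤ) ^ numAbove L l • (signedTerm σ (p + 1) (L.erase l) A (insert l B) -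
        signedTerm σ (p + 1) (L.erase l) (insert l A) B) := by
  rw [signedTerm, map_smul, tensorBoundary_faceChain, Finset.sum_union h.disjoint_left,
    Finset.sum_union h.disjoint_right, Finset.sum_union h.disjoint, smul_add, smul_add, smul_add,
    smul_add, add_add_add_comm, add_comm]
  simp only [Finset.smul_sum, ← Finset.sum_add_distrib]
  refine congrArg₂ _ (congrArg₂ _ ?_ ?_) ?_ <;> refine Finset.sum_congr rfl fun j hj => ?_
  · exact signedTerm_erase_left σ h hj
  · exact signedTerm_erase_right σ h hL hj
  · rw [signedTerm_facet_left σ h hj, signedTerm_facet_right σ h hj, ← sub_eq_add_neg, smul_sub]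

theorem swap_signedTerm (h : IsSplitting L A B) (hL : L.Nonempty) :
    swap X (signedTerm σ (p + 1) L A B) =
      (-1 : ℤ) ^ (L.card + 1) • signedTerm σ (p + 1) L B A := by
  rw [signedTerm, signedTerm, map_smul, swap_faceChain, smul_smul, smul_smul, ← pow_add,
    ← pow_add, neg_one_pow_congr_of_modEq (relSignExponent_swap h hL)]

end Splitting

end DeltaEmpty

/-- The vertex sets `A_M` for `k = 0` and `B_M` for `k = p + 1`, and in between the sets obtained by
exchanging odd and even gaps of `M` among the first `k` vertices. The two facets at `l` of the cube
with generating vectors `M ∪ {l}` correspond to `k = l` and `k = l + 1`. -/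
def mixedVertex {p : ℕ} (M : Finset (Fin (p + 1))) (k : ℕ) : Finset (Fin (p + 1)) :=
  Finset.univ.filter fun a => a ∉ M ∧ Xor (Odd (numAbove M a)) ((a : ℕ) < k)

section MixedVertex

variable {p : ℕ} {M : Finset (Fin (p + 1))} {k : ℕ} {l a : Fin (p + 1)}

theorem mem_mixedVertex :
    a ∈ mixedVertex M k ↔ a ∉ M ∧ Xor (Odd (numAbove M a)) ((a : ℕ) < k) := by
  simp [mixedVertex]

theorem mixedVertex_zero (M : Finset (Fin (p + 1))) : mixedVertex M 0 = initialVertex ∅ M := by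
  ext a
  simp [mem_mixedVertex, mem_initialVertex_empty, Xor]

theorem mixedVertex_last (M : Finset (Fin (p + 1))) :
    mixedVertex M (p + 1) = coInitialVertex ∅ M := by
  ext a
  simp [mem_mixedVertex, mem_coInitialVertex_empty, Xor, a.is_lt]

theorem mixedVertex_succ_of_mem (hl : l ∈ M) : mixedVertex M (l + 1) = mixedVertex M l := by
  ext a
  rw [mem_mixedVertex, mem_mixedVertex]
  refine and_congr_right fun ha => ?_
  have hne : (a : ℕ) ≠ l := fun h => ha (Fin.ext h ▸ hl)
  rw [Nat.lt_succ_iff_lt_or_eq, or_iff_left hne]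

theorem mem_initialVertex_insert (hl : l ∉ M) :
    a ∈ initialVertex ∅ (insert l M) ↔
      a ≠ l ∧ a ∉ M ∧ Xor (Odd (numAbove M a)) ((a : ℕ) < l) := by
  rw [mem_initialVertex_empty, odd_numAbove_insert hl, Finset.mem_insert, not_or, and_assoc,
    Fin.lt_def]

theorem mixedVertex_of_even (hl : l ∉ M) (heven : ¬ Odd (numAbove M l)) :
    mixedVertex M l = initialVertex ∅ (insert l M) ∧
      mixedVertex M (l + 1) = insert l (initialVertex ∅ (insert l M)) := by
  constructor <;> ext a <;> grind [mem_mixedVertex, mem_initialVertex_insert, Xor]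

theorem mixedVertex_of_odd (hl : l ∉ M) (hodd : Odd (numAbove M l)) :
    mixedVertex M l = insert l (initialVertex ∅ (insert l M)) ∧
      mixedVertex M (l + 1) = initialVertex ∅ (insert l M) := by
  constructor <;> ext a <;> grind [mem_mixedVertex, mem_initialVertex_insert, Xor]

end MixedVertex

section Telescope

variable {p : ℕ} (σ : SingularSimplex X p) (M : Finset (Fin (p + 1)))

/-- The term of the splitting of the whole simplex that is determined by `M` and `A`. -/
def splitTerm (A : Finset (Fin (p + 1))) : Chains X ⊗[ℤ] Chains X :=
  signedTerm σ (p + 1) M A (M ∪ A)ᶜ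

variable {M} in
theorem facets_eq_sub {l : Fin (p + 1)} (hl : l ∉ M) :
    (-1 : ℤ) ^ numAbove (insert l M) l •
      (signedTerm σ (p + 1) M (initialVertex ∅ (insert l M))
          (insert l (coInitialVertex ∅ (insert l M))) -
        signedTerm σ (p + 1) M (insert l (initialVertex ∅ (insert l M)))
          (coInitialVertex ∅ (insert l M))) =
      splitTerm σ M (mixedVertex M l) - splitTerm σ M (mixedVertex M (l + 1)) := by
  have hinitial : l ∉ M ∪ initialVertex ∅ (insert l M) := by
    simp [hl, mem_initialVertex_empty]
  have hcompl : (M ∪ initialVertex ∅ (insert l M))ᶜ =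
      insert l (coInitialVertex ∅ (insert l M)) := by
    rw [coInitialVertex, Finset.insert_union, Finset.compl_insert,
      Finset.insert_erase (Finset.mem_compl.mpr hinitial)]
  have hcompl_insert : (M ∪ insert l (initialVertex ∅ (insert l M)))ᶜ =
      coInitialVertex ∅ (insert l M) := by
    rw [coInitialVertex, Finset.insert_union_comm]
  rw [numAbove_insert_self, splitTerm, splitTerm]
  by_cases hodd : Odd (numAbove M l)
  · obtain ⟨h, h'⟩ := mixedVertex_of_odd hl hodd
    rw [h, h', hcompl, hcompl_insert, hodd.neg_one_pow]
    exact (neg_one_smul ℤ (_ : Chains X ⊗[ℤ] Chains X)).trans (neg_sub _ _)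
  · obtain ⟨h, h'⟩ := mixedVertex_of_even hl hodd
    rw [h, h', hcompl, hcompl_insert, (Nat.not_odd_iff_even.mp hodd).neg_one_pow]
    exact one_smul ℤ _

theorem sum_facets_telescope :
    ∑ l ∈ Mᶜ, (splitTerm σ M (mixedVertex M l) - splitTerm σ M (mixedVertex M (l + 1))) =
      splitTerm σ M (initialVertex ∅ M) - splitTerm σ M (coInitialVertex ∅ M) := by
  rw [Finset.sum_subset (Finset.subset_univ _) fun l _ hl => ?_]
  · rw [Fin.sum_univ_eq_sum_range (fun k => splitTerm σ M (mixedVertex M k) -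
      splitTerm σ M (mixedVertex M (k + 1))), Finset.sum_range_sub', mixedVertex_zero,
      mixedVertex_last]
  · rw [mixedVertex_succ_of_mem (by simpa using hl), sub_self]

end Telescope

section Homotopy

variable {p : ℕ} (σ : SingularSimplex X p) (i : ℕ)

theorem deltaEmpty_boundary_simplexChain :
    deltaEmpty X i (boundary X (simplexChain σ)) =
      ∑ L ∈ Finset.powersetCard (i + 1) Finset.univ,
        ∑ j ∈ initialVertex ∅ L ∪ coInitialVertex ∅ L, (-1 : ℤ) ^ (j : ℕ) •
          signedTerm σ p L ((initialVertex ∅ L).erase j) ((coInitialVertex ∅ L).erase j) := by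
  have hterm (j : Fin (p + 1)) :
      deltaEmpty X i ((-1 : ℤ) ^ (j : ℕ) • faceChain σ (Finset.univ.erase j)) =
        ∑ L ∈ Finset.powersetCard (i + 1) (Finset.univ.erase j), (-1 : ℤ) ^ (j : ℕ) •
          signedTerm σ p L ((initialVertex ∅ L).erase j) ((coInitialVertex ∅ L).erase j) := by
    rw [map_smul, deltaEmpty_faceChain, Finset.smul_sum]
    simp [Finset.inter_erase]
  rw [boundary_simplexChain, map_sum, Finset.sum_congr rfl fun j _ => hterm j]
  refine Finset.sum_comm' fun j L => ?_
  simp only [Finset.mem_univ, true_and, Finset.mem_powersetCard, Finset.subset_erase,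
    Finset.subset_univ, Finset.mem_union, mem_initialVertex_empty, mem_coInitialVertex_empty]
  tauto

theorem tensorBoundary_deltaEmpty_simplexChain :
    tensorBoundary X (deltaEmpty X i (simplexChain σ)) =
      (-1 : ℤ) ^ i • deltaEmpty X i (boundary X (simplexChain σ)) +
        ∑ M ∈ Finset.powersetCard i Finset.univ,
          (splitTerm σ M (initialVertex ∅ M) - splitTerm σ M (coInitialVertex ∅ M)) := by
  rw [deltaEmpty_simplexChain, map_sum, deltaEmpty_boundary_simplexChain, Finset.smul_sum]
  have hterm (L : Finset (Fin (p + 1))) (hL : L ∈ Finset.powersetCard (i + 1) Finset.univ) :=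
    tensorBoundary_signedTerm σ (isSplitting_initialVertex L)
      (Finset.card_pos.mp (by rw [(Finset.mem_powersetCard.mp hL).2]; exact i.succ_pos))
  rw [Finset.sum_congr rfl hterm, Finset.sum_add_distrib, sum_powersetCard_succ]
  congr 1
  · refine Finset.sum_congr rfl fun L hL => ?_
    rw [(Finset.mem_powersetCard.mp hL).2, add_assoc, pow_add, one_add_one_eq_two, neg_one_sq,
      mul_one]
  · refine Finset.sum_congr rfl fun M _ => ?_
    rw [← sum_facets_telescope]
    refine Finset.sum_congr rfl fun l hl => ?_
    rw [← facets_eq_sub σ (Finset.mem_compl.mp hl),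
      Finset.erase_insert (Finset.mem_compl.mp hl)]

theorem splitTerm_coInitialVertex (M : Finset (Fin (p + 1))) :
    splitTerm σ M (coInitialVertex ∅ M) =
      signedTerm σ (p + 1) M (coInitialVertex ∅ M) (initialVertex ∅ M) := by
  rw [splitTerm, (isSplitting_initialVertex M).symm.compl_union]

theorem homotopyFormula_deltaEmpty (X : Type*) [TopologicalSpace X] (i : ℕ) :
    HomotopyFormula i (deltaEmpty X i) := by
  refine chains_hom_ext fun p σ => ?_
  change tensorBoundary X (deltaEmpty X i _) - (-1 : ℤ) ^ i • deltaEmpty X i (boundary X _) =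
    deltaEmptyPred X i _ + (-1 : ℤ) ^ i • swap X (deltaEmptyPred X i _)
  rw [tensorBoundary_deltaEmpty_simplexChain, add_sub_cancel_left]
  cases i with
  | zero =>
    have hempty : initialVertex ∅ (∅ : Finset (Fin (p + 1))) = ∅ := by
      ext a
      simp [mem_initialVertex_empty, numAbove]
    rw [Finset.powersetCard_zero, Finset.sum_singleton, splitTerm_coInitialVertex, hempty]
    simp [splitTerm, signedTerm, deltaEmptyPred]
  | succ i =>
    rw [deltaEmptyPred, deltaEmpty_simplexChain, map_sum, Finset.smul_sum,
      ← Finset.sum_add_distrib]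
    refine Finset.sum_congr rfl fun M hM => ?_
    have hcard := (Finset.mem_powersetCard.mp hM).2
    rw [swap_signedTerm σ (isSplitting_initialVertex M) (Finset.card_pos.mp (by omega)), hcard,
      smul_smul, splitTerm_coInitialVertex, sub_eq_add_neg, ← pow_add, Odd.neg_one_pow (by grind)]
    congr 1
    exact (neg_one_smul ℤ (_ : Chains X ⊗[ℤ] Chains X)).symm

theorem normalized_deltaEmpty (X : Type*) [TopologicalSpace X] (i : ℕ) :
    Normalized i (deltaEmpty X i) := by
  rintro rfl σ
  have huniv : Finset.powersetCard (0 + 1) (Finset.univ : Finset (Fin 1)) = {Finset.univ} := rfl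
  have hinitial : initialVertex ∅ (Finset.univ : Finset (Fin 1)) = ∅ := rfl
  have hcoinitial : coInitialVertex ∅ (Finset.univ : Finset (Fin 1)) = ∅ := rfl
  rw [deltaEmpty_simplexChain, huniv, Finset.sum_singleton, hinitial, hcoinitial, signedTerm,
    Finset.union_empty, faceChain_univ]
  exact one_smul ℤ _

end Homotopy

/-! ### Singular simplices with isolated faces -/

section StdSimplex

variable {m n p : ℕ}

/-- An interior point of the standard simplex, different from the barycenter in positive
dimensions. -/
def skewPoint (m : ℕ) : stdSimplex ℝ (Fin (m + 1)) :=
  ⟨(1 / 2 : ℝ) • (stdSimplex.barycenter : stdSimplex ℝ (Fin (m + 1))).1 +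
      (1 / 2 : ℝ) • (stdSimplex.vertex 0 : stdSimplex ℝ (Fin (m + 1))).1,
    convex_stdSimplex ℝ _ (Subtype.prop _) (Subtype.prop _) (by norm_num) (by norm_num)
      (by norm_num)⟩

theorem barycenter_pos (k : Fin (m + 1)) :
    0 < (stdSimplex.barycenter : stdSimplex ℝ (Fin (m + 1))) k := by
  rw [show stdSimplex.barycenter k = (m + 1 : ℝ)⁻¹ from
    (stdSimplex.barycenter_apply k).trans (by simp)]
  positivity

theorem skewPoint_apply (k : Fin (m + 1)) :
    skewPoint m k = 1 / 2 * (stdSimplex.barycenter : stdSimplex ℝ (Fin (m + 1))) k +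
      1 / 2 * if k = 0 then 1 else 0 := by
  have h : skewPoint m k = 1 / 2 * (stdSimplex.barycenter : stdSimplex ℝ (Fin (m + 1))) k +
      1 / 2 * (stdSimplex.vertex 0 : stdSimplex ℝ (Fin (m + 1))) k := rfl
  rw [h, stdSimplex.vertex_coe, Pi.single_apply]

theorem skewPoint_pos (k : Fin (m + 1)) : 0 < skewPoint m k := by
  have := barycenter_pos k
  rw [skewPoint_apply]
  split_ifs <;> positivity

theorem barycenter_ne_skewPoint (hm : m ≠ 0) :
    (stdSimplex.barycenter : stdSimplex ℝ (Fin (m + 1))) ≠ skewPoint m := by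
  intro h
  have hlast := congrArg (fun s : stdSimplex ℝ (Fin (m + 1)) => s (Fin.last m)) h
  have hpos := barycenter_pos (Fin.last m)
  simp only [skewPoint_apply, if_neg (Fin.last_eq_zero_iff.not.mpr hm)] at hlast
  linarith

theorem map_apply_of_injective {e : Fin m → Fin n} (he : Function.Injective e)
    (s : stdSimplex ℝ (Fin m)) (k : Fin m) : stdSimplex.map e s (e k) = s k := by
  rw [stdSimplex.map_coe, FunOnFinite.linearMap_apply_apply,
    Finset.sum_eq_single k (fun b hb hbk => absurd (he (by simpa using hb)) hbk) (by simp)]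

theorem map_apply_of_notMem_range {e : Fin m → Fin n} (s : stdSimplex ℝ (Fin m)) {a : Fin n}
    (ha : a ∉ Set.range e) : stdSimplex.map e s a = 0 := by
  rw [stdSimplex.map_coe, FunOnFinite.linearMap_apply_apply]
  exact Finset.sum_eq_zero fun b hb => absurd ⟨b, by simpa using hb⟩ ha

/-- The point of the face spanned by `S` given by a family of points of the standard simplices. -/
def facePoint (b : ∀ m : ℕ, stdSimplex ℝ (Fin (m + 1))) (S : Finset (Fin (p + 1)))
    (hS : S.Nonempty) : stdSimplex ℝ (Fin (p + 1)) :=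
  stdSimplex.map (vertexMap S hS) (b (S.card - 1))

variable {b c : ∀ m : ℕ, stdSimplex ℝ (Fin (m + 1))} {S T : Finset (Fin (p + 1))}
  {hS : S.Nonempty} {hT : T.Nonempty}

theorem facePoint_pos_iff (hb : ∀ m k, 0 < b m k) (a : Fin (p + 1)) :
    0 < facePoint b S hS a ↔ a ∈ S := by
  have hmem : a ∈ S ↔ a ∈ Set.range (vertexMap S hS) := by
    conv_lhs => rw [← map_vertexMap_univ S hS]
    simp
  rw [hmem]
  refine ⟨fun h => ?_, ?_⟩
  · by_contra hn
    exact h.ne' (map_apply_of_notMem_range _ hn)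
  · rintro ⟨k, rfl⟩
    rw [facePoint, map_apply_of_injective (vertexMap S hS).injective]
    exact hb _ _

theorem eq_of_facePoint_eq (hb : ∀ m k, 0 < b m k) (hc : ∀ m k, 0 < c m k)
    (h : facePoint b S hS = facePoint c T hT) : S = T := by
  ext a
  rw [← facePoint_pos_iff (hS := hS) hb, ← facePoint_pos_iff (hS := hT) hc, h]

theorem point_eq_of_facePoint_eq (h : facePoint b S hS = facePoint c S hS) :
    b (S.card - 1) = c (S.card - 1) := by
  ext k
  have := congrArg (fun s : stdSimplex ℝ (Fin (p + 1)) => s (vertexMap S hS k)) h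
  simpa only [facePoint, map_apply_of_injective (vertexMap S hS).injective] using this

end StdSimplex

section IsolatesFace

variable {p : ℕ}

theorem exists_simplex_of_finite (hX : ∃ x y : X, x ≠ y ∧ Joined x y)
    {P : Set (stdSimplex ℝ (Fin (p + 1)))} (hP : P.Finite) (Q : Set (stdSimplex ℝ (Fin (p + 1)))) :
    ∃ σ : SingularSimplex X p, ∀ s ∈ P, ∀ t ∈ P, σ s = σ t → (s ∈ Q ↔ t ∈ Q) := by
  obtain ⟨x, y, hxy, ⟨γ⟩⟩ := hX
  obtain ⟨f, hf0, hf1, -⟩ := exists_continuous_zero_one_of_isClosed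
    (hP.subset Set.inter_subset_left : (P ∩ Qᶜ).Finite).isClosed
    (hP.subset Set.inter_subset_left : (P ∩ Q).Finite).isClosed
    (disjoint_compl_left.mono Set.inter_subset_right Set.inter_subset_right)
  have hx {s} (hs : s ∈ P) (hsQ : s ∉ Q) : γ.extend (f s) = x := by simp [hf0 ⟨hs, hsQ⟩]
  have hy {s} (hs : s ∈ P) (hsQ : s ∈ Q) : γ.extend (f s) = y := by simp [hf1 ⟨hs, hsQ⟩]
  refine ⟨⟨fun s => γ.extend (f s), γ.continuous_extend.comp f.continuous⟩, fun s hs t ht h => ?_⟩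
  change γ.extend (f s) = γ.extend (f t) at h
  by_cases hsQ : s ∈ Q <;> by_cases htQ : t ∈ Q <;> simp only [hsQ, htQ]
  · rw [hy hs hsQ, hx ht htQ] at h
    exact absurd h.symm hxy
  · rw [hx hs hsQ, hy ht htQ] at h
    exact absurd h hxy

/-- The face of `σ` spanned by `S₀` differs from all other faces of `σ`. -/
def IsolatesFace (σ : SingularSimplex X p) (S₀ : Finset (Fin (p + 1))) : Prop :=
  ∀ S, faceChain σ S = faceChain σ S₀ → S = S₀

variable {σ : SingularSimplex X p} {S₀ T₀ : Finset (Fin (p + 1))}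

theorem isolatesFace_of_facePoint (hS₀ : S₀.Nonempty) (b : ∀ m : ℕ, stdSimplex ℝ (Fin (m + 1)))
    (h : ∀ S hS, S.card = S₀.card → σ (facePoint b S hS) = σ (facePoint b S₀ hS₀) → S = S₀) :
    IsolatesFace σ S₀ := by
  intro S hσ
  rcases S.eq_empty_or_nonempty with rfl | hS
  · rw [faceChain_empty, faceChain_of_nonempty σ hS₀] at hσ
    exact absurd hσ.symm (Finsupp.single_ne_zero.mpr one_ne_zero)
  rw [faceChain_of_nonempty σ hS, faceChain_of_nonempty σ hS₀] at hσ
  replace hσ := Finsupp.single_left_injective one_ne_zero hσ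
  have hcard : S.card - 1 = S₀.card - 1 := congrArg Sigma.fst hσ
  refine h S hS (by have := hS.card_pos; have := hS₀.card_pos; omega) ?_
  exact congrArg (fun s : Σ q : ℕ, SingularSimplex X q => s.2 (b s.1)) hσ

theorem IsolatesFace.exists_apply_faceChain (h : IsolatesFace σ S₀) (hS₀ : S₀.Nonempty) :
    ∃ s, ∀ S, faceChain σ S s = if S = S₀ then 1 else 0 := by
  refine ⟨⟨S₀.card - 1, face σ S₀ hS₀⟩, fun S => ?_⟩
  split_ifs with hS
  · rw [hS, faceChain_of_nonempty σ hS₀]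
    exact Finsupp.single_eq_same
  · have hne := mt (h S) hS
    rcases S.eq_empty_or_nonempty with rfl | hS'
    · rw [faceChain_empty, Finsupp.coe_zero, Pi.zero_apply]
    · rw [faceChain_of_nonempty σ hS', faceChain_of_nonempty σ hS₀] at hne
      rw [faceChain_of_nonempty σ hS']
      exact Finsupp.single_eq_of_ne' fun he => hne (congrArg (Finsupp.single · 1) he)

theorem finite_range_facePoint (b : ∀ m : ℕ, stdSimplex ℝ (Fin (m + 1))) (p : ℕ) :
    {s | ∃ (S : Finset (Fin (p + 1))) (hS : S.Nonempty), s = facePoint b S hS}.Finite :=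
  (Set.finite_range fun S : {S : Finset (Fin (p + 1)) // S.Nonempty} =>
    facePoint b S.1 S.2).subset fun _ ⟨S, hS, h⟩ => ⟨⟨S, hS⟩, h.symm⟩

theorem exists_isolatesFace_of_le_one (hX : ∃ x y : X, x ≠ y ∧ Joined x y) (hp : p ≤ 1) :
    ∃ σ : SingularSimplex X p, ∀ S : Finset (Fin (p + 1)), S.Nonempty → IsolatesFace σ S := by
  let b : ∀ m : ℕ, stdSimplex ℝ (Fin (m + 1)) := fun _ => stdSimplex.barycenter
  obtain ⟨σ, hσ⟩ := exists_simplex_of_finite hX (finite_range_facePoint b p)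
    {facePoint b {0} (Finset.singleton_nonempty 0)}
  have hmem {S : Finset (Fin (p + 1))} (hS : S.Nonempty) :
      facePoint b S hS = facePoint b {0} (Finset.singleton_nonempty 0) ↔ S = {0} :=
    ⟨eq_of_facePoint_eq (fun _ => barycenter_pos) fun _ => barycenter_pos, by rintro rfl; rfl⟩
  refine ⟨σ, fun S₀ hS₀ => isolatesFace_of_facePoint hS₀ b fun S hS hcard h => ?_⟩
  have hcolour : S = {0} ↔ S₀ = {0} := by
    rw [← hmem hS, ← hmem hS₀]
    exact hσ _ ⟨S, hS, rfl⟩ _ ⟨S₀, hS₀, rfl⟩ h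
  clear hσ h hmem
  interval_cases p <;> revert S S₀ <;> decide

theorem eq_of_facePoint_mem {b c : ∀ m : ℕ, stdSimplex ℝ (Fin (m + 1))} (hb : ∀ m k, 0 < b m k)
    (hc : ∀ m k, 0 < c m k) (hbc : ∀ m, m ≠ 0 → b m ≠ c m) {hS₀ : S₀.Nonempty}
    {hT₀ : T₀.Nonempty} (h : 3 ≤ S₀.card + T₀.card) {S : Finset (Fin (p + 1))} {hS : S.Nonempty}
    (hcard : S.card = S₀.card)
    (hmem : facePoint b S hS = facePoint b S₀ hS₀ ∨ facePoint b S hS = facePoint c T₀ hT₀) :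
    S = S₀ := by
  rcases hmem with heq | heq
  · exact eq_of_facePoint_eq hb hb heq
  · obtain rfl := eq_of_facePoint_eq hb hc heq
    exact absurd (point_eq_of_facePoint_eq heq) (hbc _ (by omega))

theorem exists_isolatesFace_pair (hX : ∃ x y : X, x ≠ y ∧ Joined x y) (hS₀ : S₀.Nonempty)
    (hT₀ : T₀.Nonempty) (h : 3 ≤ S₀.card + T₀.card) :
    ∃ σ : SingularSimplex X p, IsolatesFace σ S₀ ∧ IsolatesFace σ T₀ := by
  let b : ∀ m : ℕ, stdSimplex ℝ (Fin (m + 1)) := fun _ => stdSimplex.barycenter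
  have hb (m k) : 0 < b m k := barycenter_pos k
  have hc (m k) : 0 < skewPoint m k := skewPoint_pos k
  have hbc (m) (hm : m ≠ 0) : b m ≠ skewPoint m := barycenter_ne_skewPoint hm
  obtain ⟨σ, hσ⟩ := exists_simplex_of_finite hX
    ((finite_range_facePoint b p).union (finite_range_facePoint skewPoint p))
    {facePoint b S₀ hS₀, facePoint skewPoint T₀ hT₀}
  refine ⟨σ, isolatesFace_of_facePoint hS₀ b fun S hS hcard heq => ?_,
    isolatesFace_of_facePoint hT₀ skewPoint fun T hT hcard heq => ?_⟩
  · exact eq_of_facePoint_mem hb hc hbc h hcard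
      ((hσ _ (.inl ⟨S, hS, rfl⟩) _ (.inl ⟨S₀, hS₀, rfl⟩) heq).mpr (.inl rfl))
  · exact eq_of_facePoint_mem hc hb (fun m hm => (hbc m hm).symm) (by omega) hcard
      ((hσ _ (.inr ⟨T, hT, rfl⟩) _ (.inr ⟨T₀, hT₀, rfl⟩) heq).mpr (.inr rfl)).symm

end IsolatesFace

/-! ### Formal combinations of pairs of faces -/

/-- The coefficient of a basis element of the tensor square of the singular chains. -/
def tensorCoeff (s t : Σ q : ℕ, SingularSimplex X q) : Chains X ⊗[ℤ] Chains X →ₗ[ℤ] ℤ :=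
  TensorProduct.lift ((LinearMap.mul ℤ ℤ).compl₁₂ (Finsupp.lapply s) (Finsupp.lapply t))

theorem tensorCoeff_tmul (s t : Σ q : ℕ, SingularSimplex X q) (a b : Chains X) :
    tensorCoeff s t (a ⊗ₜ[ℤ] b) = a s * b t := rfl

section FormalValue

variable {p : ℕ}

/-- The value on `σ` of the formal combination of the pairs of faces `S ⊗ T` with coefficients
`z S T`. -/
def formalValue (z : Finset (Fin (p + 1)) → Finset (Fin (p + 1)) → ℤ) (σ : SingularSimplex X p) :
    Chains X ⊗[ℤ] Chains X :=
  ∑ S, ∑ T, z S T • (faceChain σ S ⊗ₜ[ℤ] faceChain σ T)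

theorem exists_isolatesFace (hX : ∃ x y : X, x ≠ y ∧ Joined x y)
    {S₀ T₀ : Finset (Fin (p + 1))} (hS₀ : S₀.Nonempty) (hT₀ : T₀.Nonempty)
    (h : 3 ≤ S₀.card + T₀.card ∨ p ≤ 1) :
    ∃ σ : SingularSimplex X p, IsolatesFace σ S₀ ∧ IsolatesFace σ T₀ := by
  rcases h with h | h
  · exact exists_isolatesFace_pair hX hS₀ hT₀ h
  · obtain ⟨σ, hσ⟩ := exists_isolatesFace_of_le_one hX h
    exact ⟨σ, hσ S₀ hS₀, hσ T₀ hT₀⟩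

theorem eq_zero_of_formalValue_eq_zero (hX : ∃ x y : X, x ≠ y ∧ Joined x y)
    {w : Finset (Fin (p + 1)) → Finset (Fin (p + 1)) → ℤ}
    (hw : ∀ σ : SingularSimplex X p, formalValue w σ = 0) {S₀ T₀ : Finset (Fin (p + 1))}
    (hS₀ : S₀.Nonempty) (hT₀ : T₀.Nonempty) (h : 3 ≤ S₀.card + T₀.card ∨ p ≤ 1) :
    w S₀ T₀ = 0 := by
  obtain ⟨σ, hS, hT⟩ := exists_isolatesFace hX hS₀ hT₀ h
  obtain ⟨s, hs⟩ := hS.exists_apply_faceChain hS₀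
  obtain ⟨t, ht⟩ := hT.exists_apply_faceChain hT₀
  have hcoeff : tensorCoeff s t (formalValue w σ) = w S₀ T₀ := by
    rw [formalValue, map_sum, Finset.sum_eq_single S₀, map_sum, Finset.sum_eq_single T₀] <;>
      simp +contextual [tensorCoeff_tmul, hs, ht]
  rw [← hcoeff, hw σ, map_zero]

theorem sum_smul_sum_erase {R N : Type*} [CommRing R] [AddCommGroup N] [Module R N] (k : ℕ)
    (f : Finset (Fin (p + 1)) → R) (g : Finset (Fin (p + 1)) → N) :
    ∑ S, f S • ∑ s ∈ S, (-1 : R) ^ (k + numBelow S s) • g (S.erase s) =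
      ∑ S, (∑ s ∈ Sᶜ, (-1 : R) ^ (k + numBelow S s) * f (insert s S)) • g S := by
  simp only [Finset.smul_sum, Finset.sum_smul, smul_smul]
  rw [sum_sum_mem_eq_sum_compl]
  refine Finset.sum_congr rfl fun S _ => Finset.sum_congr rfl fun s hs => ?_
  rw [numBelow_insert_self, Finset.erase_insert (Finset.mem_compl.mp hs), mul_comm]

/-- The coefficients of the boundary of a formal combination, on pairs of non-empty faces. -/
def boundaryCoeff (z : Finset (Fin (p + 1)) → Finset (Fin (p + 1)) → ℤ)
    (S T : Finset (Fin (p + 1))) : ℤ :=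
  ∑ s ∈ Sᶜ, (-1 : ℤ) ^ numBelow S s * z (insert s S) T +
    ∑ t ∈ Tᶜ, (-1 : ℤ) ^ (S.card - 1 + numBelow T t) * z S (insert t T)

theorem tensorBoundary_formalValue (z : Finset (Fin (p + 1)) → Finset (Fin (p + 1)) → ℤ)
    (σ : SingularSimplex X p) :
    tensorBoundary X (formalValue z σ) = formalValue (boundaryCoeff z) σ := by
  have hz : tensorBoundary X (formalValue z σ) = ∑ S, ∑ T, (
      z S T • ∑ s ∈ S, (-1 : ℤ) ^ numBelow S s • (faceChain σ (S.erase s) ⊗ₜ[ℤ] faceChain σ T) +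
      z S T • ∑ t ∈ T, (-1 : ℤ) ^ (S.card - 1 + numBelow T t) •
        (faceChain σ S ⊗ₜ[ℤ] faceChain σ (T.erase t))) := by
    rw [formalValue, map_sum]
    refine Finset.sum_congr rfl fun S _ => (map_sum _ _ _).trans ?_
    refine Finset.sum_congr rfl fun T _ => ?_
    rw [map_smul, tensorBoundary_faceChain, smul_add]
  have hleft (T) := sum_smul_sum_erase 0 (z · T) fun S => faceChain σ S ⊗ₜ[ℤ] faceChain σ T
  have hright (S) := sum_smul_sum_erase (S.card - 1) (z S) fun T =>
    faceChain σ S ⊗ₜ[ℤ] faceChain σ T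
  simp only [zero_add] at hleft
  simp only [hz, Finset.sum_add_distrib, hright]
  rw [Finset.sum_comm]
  simp only [hleft]
  rw [Finset.sum_comm, formalValue, ← Finset.sum_add_distrib]
  refine Finset.sum_congr rfl fun S _ => ?_
  rw [← Finset.sum_add_distrib]
  exact Finset.sum_congr rfl fun T _ => (add_smul _ _ _).symm

/-- A formal combination whose boundary vanishes; pairs with an empty face do not count. -/
def FormalCycle (z : Finset (Fin (p + 1)) → Finset (Fin (p + 1)) → ℤ) : Prop :=
  ∀ S T, S.Nonempty → T.Nonempty → boundaryCoeff z S T = 0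

theorem formalCycle_of_tensorBoundary_eq_zero (hX : ∃ x y : X, x ≠ y ∧ Joined x y)
    {z : Finset (Fin (p + 1)) → Finset (Fin (p + 1)) → ℤ}
    (hz : ∀ S T, z S T ≠ 0 → 4 ≤ S.card + T.card ∨ p ≤ 1)
    (h : ∀ σ : SingularSimplex X p, tensorBoundary X (formalValue z σ) = 0) : FormalCycle z := by
  intro S T hS hT
  by_cases hST : 3 ≤ S.card + T.card ∨ p ≤ 1
  · refine eq_zero_of_formalValue_eq_zero hX (fun σ => ?_) hS hT hST
    rw [← tensorBoundary_formalValue, h]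
  · have hleft {s} (hs : s ∈ Sᶜ) : z (insert s S) T = 0 := by
      by_contra hne
      have := hz _ _ hne
      rw [Finset.card_insert_of_notMem (Finset.mem_compl.mp hs)] at this
      omega
    have hright {t} (ht : t ∈ Tᶜ) : z S (insert t T) = 0 := by
      by_contra hne
      have := hz _ _ hne
      rw [Finset.card_insert_of_notMem (Finset.mem_compl.mp ht)] at this
      omega
    rw [boundaryCoeff, Finset.sum_eq_zero fun s hs => by rw [hleft hs, mul_zero],
      Finset.sum_eq_zero fun t ht => by rw [hright ht, mul_zero], add_zero]

end FormalValue

/-! ### Formal cycles modulo two -/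

section ModTwoCycle

variable {V : Type*} [Fintype V] [DecidableEq V]

/-- The reduction modulo two of `FormalCycle`; it does not refer to the order of the vertices. -/
def ModTwoCycle (w : Finset V → Finset V → ZMod 2) : Prop :=
  ∀ S T, S.Nonempty → T.Nonempty →
    ∑ s ∈ Sᶜ, w (insert s S) T + ∑ t ∈ Tᶜ, w S (insert t T) = 0

theorem sum_sum_insert_singleton_eq_zero (f : Finset V → ZMod 2) :
    ∑ s, ∑ t ∈ {s}ᶜ, f (insert t {s}) = 0 := by
  rw [Finset.sum_sigma']
  refine Finset.sum_involution (fun x _ => ⟨x.2, x.1⟩) ?_ ?_ ?_ fun _ _ => rfl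
  · rintro ⟨s, t⟩ -
    rw [Finset.pair_comm]
    exact CharTwo.add_self_eq_zero _
  · rintro ⟨s, t⟩ hst - heq
    simp only [Finset.mem_sigma, Finset.mem_compl, Finset.mem_singleton] at hst
    exact hst.2 (congrArg Sigma.fst heq)
  · rintro ⟨s, t⟩ hst
    simpa [eq_comm] using hst

variable {w : Finset V → Finset V → ZMod 2}

theorem ModTwoCycle.sum_univ_singleton [Nontrivial V] (h : ModTwoCycle w) :
    ∑ t, w Finset.univ {t} = 0 := by
  obtain ⟨v, u, huv⟩ := exists_pair_ne V
  have hfacet (t) : w Finset.univ {t} + ∑ t' ∈ {t}ᶜ, w {v}ᶜ (insert t' {t}) = 0 := by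
    have := h {v}ᶜ {t} ⟨u, by simpa using huv.symm⟩ (Finset.singleton_nonempty t)
    rwa [compl_compl, Finset.sum_singleton, Finset.insert_compl_self] at this
  have hsum := Finset.sum_eq_zero fun t (_ : t ∈ Finset.univ) => hfacet t
  rwa [Finset.sum_add_distrib, sum_sum_insert_singleton_eq_zero, add_zero] at hsum

theorem ModTwoCycle.sum_erase_eq_zero [Nontrivial V] (h : ModTwoCycle w) {L S : Finset V} {l : V}
    (hl : l ∈ L) (hS : L ⊆ S) :
    ∑ s ∈ Sᶜ, w (insert s S) (Sᶜ ∪ L.erase l) +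
      (w S (Sᶜ ∪ L) + ∑ t ∈ S \ L, w S (insert t (Sᶜ ∪ L.erase l))) = 0 := by
  have hcompl : (Sᶜ ∪ L.erase l)ᶜ = insert l (S \ L) := by
    ext a
    have := @hS a
    simp only [Finset.mem_compl, Finset.mem_union, Finset.mem_erase, Finset.mem_insert,
      Finset.mem_sdiff]
    grind
  have hT : w S (Sᶜ ∪ L) + ∑ t ∈ S \ L, w S (insert t (Sᶜ ∪ L.erase l)) =
      ∑ t ∈ (Sᶜ ∪ L.erase l)ᶜ, w S (insert t (Sᶜ ∪ L.erase l)) := by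
    rw [hcompl, Finset.sum_insert (by simp [hl]), ← Finset.union_insert, Finset.insert_erase hl]
  rw [hT]
  rcases (Sᶜ ∪ L.erase l).eq_empty_or_nonempty with hempty | hne
  · obtain rfl := (Finset.compl_eq_empty_iff S).mp (Finset.union_eq_empty.mp hempty).1
    rw [hempty]
    simpa using h.sum_univ_singleton
  · exact h S _ ⟨l, hS hl⟩ hne

theorem ModTwoCycle.sum_Ici_eq_zero [Nontrivial V] (h : ModTwoCycle w) {L : Finset V}
    (hL : L.Nonempty) : ∑ S ∈ Finset.Ici L, w S (Sᶜ ∪ L) = 0 := by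
  obtain ⟨l, hl⟩ := hL
  have hcancel : ∑ S ∈ Finset.Ici L, ∑ t ∈ S \ L, w S (insert t (Sᶜ ∪ L.erase l)) =
      ∑ S ∈ Finset.Ici L, ∑ s ∈ Sᶜ, w (insert s S) (Sᶜ ∪ L.erase l) := by
    rw [sum_sdiff_eq_sum_compl]
    refine Finset.sum_congr rfl fun S _ => Finset.sum_congr rfl fun s hs => ?_
    rw [← Finset.insert_union, Finset.compl_insert, Finset.insert_erase hs]
  have hsum := Finset.sum_eq_zero fun S hS => h.sum_erase_eq_zero hl (Finset.mem_Ici.mp hS)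
  rwa [Finset.sum_add_distrib, Finset.sum_add_distrib, hcancel, add_left_comm,
    CharTwo.add_self_eq_zero, add_zero] at hsum

end ModTwoCycle

/-! ### Tight families of coefficients -/

section Tight

variable {V : Type*} [Fintype V] [DecidableEq V] {i : ℕ} {S T L : Finset V}
  {c d : Finset V → Finset V → ℤ}

theorem union_eq_univ_and_inter_eq_iff :
    S ∪ T = Finset.univ ∧ S ∩ T = L ↔ L ⊆ S ∧ T = Sᶜ ∪ L := by
  simp only [Finset.ext_iff, Finset.subset_iff, Finset.mem_union, Finset.mem_inter,
    Finset.mem_compl, Finset.mem_univ, iff_true]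
  grind

/-- Exactly one pair `S ⊗ T` occurs for each set `L` of `i + 1` vertices as `S ∩ T`; it satisfies
`S ∪ T = V` and has an odd coefficient. No other pair occurs. -/
structure Tight (i : ℕ) (c : Finset V → Finset V → ℤ) : Prop where
  union_eq : ∀ {S T}, c S T ≠ 0 → S ∪ T = Finset.univ
  card_inter : ∀ {S T}, c S T ≠ 0 → (S ∩ T).card = i + 1
  inj : ∀ {S T S' T'}, c S T ≠ 0 → c S' T' ≠ 0 → S ∩ T = S' ∩ T' → S = S'
  exists_odd : ∀ L : Finset V, L.card = i + 1 →
    ∃ S T, S ∪ T = Finset.univ ∧ S ∩ T = L ∧ Odd (c S T)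

theorem ne_zero_of_odd {n : ℤ} (h : Odd n) : n ≠ 0 := by
  rintro rfl
  exact absurd h (by decide)

theorem Tight.card_add_card (hc : Tight i c) (h : c S T ≠ 0) :
    S.card + T.card = Fintype.card V + (i + 1) := by
  rw [← Finset.card_union_add_card_inter, hc.union_eq h, hc.card_inter h, Finset.card_univ]

theorem Tight.inj_right (hc : Tight i c) {S' T' : Finset V} (h : c S T ≠ 0) (h' : c S' T' ≠ 0)
    (hinter : S ∩ T = S' ∩ T') : T = T' := by
  rw [(union_eq_univ_and_inter_eq_iff.mp ⟨hc.union_eq h, hinter⟩).2, hc.inj h h' hinter,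
    ← (union_eq_univ_and_inter_eq_iff.mp ⟨hc.union_eq h', rfl⟩).2]

theorem Tight.apply_swap_eq_zero (hc : Tight i c) (hi : i + 1 < Fintype.card V) (h : c S T ≠ 0) :
    c T S = 0 := by
  by_contra h'
  obtain rfl := hc.inj h h' (Finset.inter_comm S T)
  have hunion := hc.union_eq h
  have hcard := hc.card_inter h
  rw [Finset.union_self] at hunion
  rw [Finset.inter_self, hunion, Finset.card_univ] at hcard
  exact hi.ne' hcard

theorem Tight.mul_swap (hc : Tight i c) {ε : Finset V → Finset V → ℤ} (hε : ∀ S T, Odd (ε S T)) :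
    Tight i fun S T => ε S T * c T S where
  union_eq {S T} h := by rw [Finset.union_comm, hc.union_eq (right_ne_zero_of_mul h)]
  card_inter {S T} h := by rw [Finset.inter_comm, hc.card_inter (right_ne_zero_of_mul h)]
  inj {S T S' T'} h h' hinter := by
    rw [Finset.inter_comm S T, Finset.inter_comm S' T'] at hinter
    exact hc.inj_right (right_ne_zero_of_mul h) (right_ne_zero_of_mul h') hinter
  exists_odd L hL := by
    obtain ⟨S, T, hunion, hinter, hodd⟩ := hc.exists_odd L hL
    exact ⟨T, S, by rw [Finset.union_comm, hunion], by rw [Finset.inter_comm, hinter],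
      (hε T S).mul hodd⟩

theorem Tight.card_support_le (hc : Tight i c) :
    (Finset.univ.filter fun ST : Finset V × Finset V => c ST.1 ST.2 ≠ 0).card ≤
      (Fintype.card V).choose (i + 1) := by
  rw [← Finset.card_univ, ← Finset.card_powersetCard]
  refine Finset.card_le_card_of_injOn (fun ST => ST.1 ∩ ST.2) (fun ST h => ?_) ?_
  · simpa using hc.card_inter (Finset.mem_filter.mp h).2
  · intro ST h ST' h' hinter
    replace h := (Finset.mem_filter.mp h).2
    replace h' := (Finset.mem_filter.mp h').2
    exact Prod.ext (hc.inj h h' hinter) (hc.inj_right h h' hinter)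

theorem tight_of_exists_odd
    (hodd : ∀ L : Finset V, L.card = i + 1 →
      ∃ S T, S ∪ T = Finset.univ ∧ S ∩ T = L ∧ Odd (d S T))
    (hcard : (Finset.univ.filter fun ST : Finset V × Finset V => d ST.1 ST.2 ≠ 0).card ≤
      (Fintype.card V).choose (i + 1)) : Tight i d := by
  choose! s t hunion hinter hst using hodd
  have himage : (Finset.powersetCard (i + 1) Finset.univ).image (fun L => (s L, t L)) =
      Finset.univ.filter fun ST : Finset V × Finset V => d ST.1 ST.2 ≠ 0 := by
    refine Finset.eq_of_subset_of_card_le (fun ST h => ?_) ?_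
    · obtain ⟨L, hL, rfl⟩ := Finset.mem_image.mp h
      exact Finset.mem_filter.mpr ⟨Finset.mem_univ _,
        ne_zero_of_odd (hst L (Finset.mem_powersetCard.mp hL).2)⟩
    · rwa [Finset.card_image_of_injOn, Finset.card_powersetCard, Finset.card_univ]
      intro L hL L' hL' heq
      have hs : s L = s L' := congrArg Prod.fst heq
      have ht : t L = t L' := congrArg Prod.snd heq
      rw [← hinter L (Finset.mem_powersetCard.mp hL).2, hs, ht,
        hinter L' (Finset.mem_powersetCard.mp hL').2]
  have hsupp {S T} (h : d S T ≠ 0) : ∃ L, L.card = i + 1 ∧ s L = S ∧ t L = T := by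
    have hmem : (S, T) ∈ Finset.univ.filter fun ST : Finset V × Finset V => d ST.1 ST.2 ≠ 0 :=
      Finset.mem_filter.mpr ⟨Finset.mem_univ _, h⟩
    obtain ⟨L, hL, heq⟩ := Finset.mem_image.mp (himage ▸ hmem)
    exact ⟨L, (Finset.mem_powersetCard.mp hL).2, Prod.ext_iff.mp heq⟩
  refine ⟨fun h => ?_, fun h => ?_, fun h h' hST => ?_, fun L hL =>
    ⟨s L, t L, hunion L hL, hinter L hL, hst L hL⟩⟩
  · obtain ⟨L, hL, rfl, rfl⟩ := hsupp h
    exact hunion L hL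
  · obtain ⟨L, hL, rfl, rfl⟩ := hsupp h
    rwa [hinter L hL]
  · obtain ⟨L, hL, rfl, rfl⟩ := hsupp h
    obtain ⟨L', hL', rfl, rfl⟩ := hsupp h'
    rw [hinter L hL, hinter L' hL'] at hST
    rw [hST]

theorem Tight.sum_Ici_eq_one (hc : Tight i c) (hL : L.card = i + 1) :
    ∑ S ∈ Finset.Ici L, (c S (Sᶜ ∪ L) : ZMod 2) = 1 := by
  obtain ⟨S₀, T₀, hunion, hinter, hodd⟩ := hc.exists_odd L hL
  obtain ⟨hLS, rfl⟩ := union_eq_univ_and_inter_eq_iff.mp ⟨hunion, hinter⟩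
  rw [Finset.sum_eq_single_of_mem S₀ (Finset.mem_Ici.mpr hLS)]
  · exact ZMod.intCast_eq_one_iff_odd.mpr hodd
  · intro S hS hne
    have hinter' := (union_eq_univ_and_inter_eq_iff.mpr ⟨Finset.mem_Ici.mp hS, rfl⟩).2
    have hzero : c S (Sᶜ ∪ L) = 0 :=
      not_not.mp fun h => hne (hc.inj h (ne_zero_of_odd hodd) (hinter'.trans hinter.symm))
    rw [hzero, Int.cast_zero]

theorem Tight.exists_odd_of_modTwoCycle [Nontrivial V] (hc : Tight i c)
    (hz : ModTwoCycle fun S T => ((d - c) S T : ZMod 2)) (hL : L.card = i + 1) :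
    ∃ S T, S ∪ T = Finset.univ ∧ S ∩ T = L ∧ Odd (d S T) := by
  have hsum := hz.sum_Ici_eq_zero (L := L) (Finset.card_pos.mp (by omega))
  simp only [Pi.sub_apply, Int.cast_sub, Finset.sum_sub_distrib, hc.sum_Ici_eq_one hL,
    sub_eq_zero] at hsum
  obtain ⟨S, hS, hne⟩ := Finset.exists_ne_zero_of_sum_ne_zero (hsum.trans_ne one_ne_zero)
  obtain ⟨hunion, hinter⟩ := union_eq_univ_and_inter_eq_iff.mpr ⟨Finset.mem_Ici.mp hS, rfl⟩
  refine ⟨S, Sᶜ ∪ L, hunion, hinter, Int.not_even_iff_odd.mp fun heven => hne ?_⟩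
  exact ZMod.intCast_eq_zero_iff_even.mpr heven

theorem Tight.eq_or_eq_or_eq (hc : Tight i c) (hd : Tight i d) {S₁ T₁ S₂ T₂ S₃ T₃ : Finset V}
    (h₁ : (d - c) S₁ T₁ ≠ 0) (h₂ : (d - c) S₂ T₂ ≠ 0) (h₃ : (d - c) S₃ T₃ ≠ 0)
    (h₁₂ : S₁ ∩ T₁ = S₂ ∩ T₂) (h₁₃ : S₁ ∩ T₁ = S₃ ∩ T₃) : S₁ = S₂ ∨ S₁ = S₃ ∨ S₂ = S₃ := by
  have hsupp {S T} (h : (d - c) S T ≠ 0) : c S T ≠ 0 ∨ d S T ≠ 0 := by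
    rw [Pi.sub_apply, Pi.sub_apply] at h
    omega
  have h₂₃ := h₁₂.symm.trans h₁₃
  rcases hsupp h₁ with h₁ | h₁ <;> rcases hsupp h₂ with h₂ | h₂ <;>
    rcases hsupp h₃ with h₃ | h₃ <;>
    first
    | exact .inl (hc.inj h₁ h₂ h₁₂)
    | exact .inl (hd.inj h₁ h₂ h₁₂)
    | exact .inr (.inl (hc.inj h₁ h₃ h₁₃))
    | exact .inr (.inl (hd.inj h₁ h₃ h₁₃))
    | exact .inr (.inr (hc.inj h₂ h₃ h₂₃))
    | exact .inr (.inr (hd.inj h₂ h₃ h₂₃))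

end Tight

/-! ### Tight families that differ by a cycle -/

section TightCycle

open scoped symmDiff

variable {p i : ℕ} {c c' d z : Finset (Fin (p + 1)) → Finset (Fin (p + 1)) → ℤ}
  {S T : Finset (Fin (p + 1))} {j : Fin (p + 1)}

theorem FormalCycle.modTwo (h : FormalCycle z) : ModTwoCycle fun S T => (z S T : ZMod 2) := by
  intro S T hS hT
  have hST := congrArg (Int.cast : ℤ → ZMod 2) (h S T hS hT)
  rw [boundaryCoeff] at hST
  push_cast at hST
  simpa only [show (-1 : ZMod 2) = 1 from rfl, one_pow, one_mul] using hST

theorem Tight.of_card_support_le (hc : Tight i c) (hp : 1 ≤ p) (hz : FormalCycle (d - c))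
    (hcard : (Finset.univ.filter fun ST : Finset (Fin (p + 1)) × Finset (Fin (p + 1)) =>
      d ST.1 ST.2 ≠ 0).card ≤ (p + 1).choose (i + 1)) : Tight i d := by
  have : Nontrivial (Fin (p + 1)) := Fin.nontrivial_iff_two_le.mpr (by omega)
  exact tight_of_exists_odd (fun L hL => hc.exists_odd_of_modTwoCycle hz.modTwo hL)
    (hcard.trans_eq (by rw [Fintype.card_fin]))

theorem eq_zero_iff_of_sign_mul_add_sign_mul {m n : ℕ} {a b : ℤ}
    (h : (-1 : ℤ) ^ m * a + (-1 : ℤ) ^ n * b = 0) : a = 0 ↔ b = 0 := by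
  rcases neg_one_pow_eq_or ℤ m with hm | hm <;> rcases neg_one_pow_eq_or ℤ n with hn | hn <;>
    rw [hm, hn] at h <;> omega

theorem FormalCycle.insert_eq_zero_iff (hz : FormalCycle z)
    (hcover : ∀ S T, z S T ≠ 0 → S ∪ T = Finset.univ) (hS : S.Nonempty) (hT : T.Nonempty)
    (hjS : j ∉ S) (hjT : j ∉ T) : z (insert j S) T = 0 ↔ z S (insert j T) = 0 := by
  have hzero {A B} (h : j ∉ A ∪ B) : z A B = 0 :=
    not_not.mp fun hne => h (hcover A B hne ▸ Finset.mem_univ j)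
  have h := hz S T hS hT
  rw [boundaryCoeff, Finset.sum_eq_single_of_mem j (Finset.mem_compl.mpr hjS),
    Finset.sum_eq_single_of_mem j (Finset.mem_compl.mpr hjT)] at h
  · exact eq_zero_iff_of_sign_mul_add_sign_mul h
  · intro t _ ht
    rw [hzero (by simp [hjS, hjT, ht.symm]), mul_zero]
  · intro s _ hs
    rw [hzero (by simp [hjS, hjT, hs.symm]), mul_zero]

theorem symmDiff_singleton_of_mem (hj : j ∈ S) : S ∆ {j} = S.erase j := by
  ext a
  by_cases ha : a = j <;> simp [Finset.mem_symmDiff, ha, hj]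

theorem symmDiff_singleton_of_notMem (hj : j ∉ S) : S ∆ {j} = insert j S := by
  ext a
  by_cases ha : a = j <;> simp [Finset.mem_symmDiff, ha, hj]

theorem inter_symmDiff_singleton (hunion : j ∈ S ∪ T) (hinter : j ∉ S ∩ T) :
    S ∆ {j} ∩ T ∆ {j} = S ∩ T := by
  ext a
  by_cases ha : a = j
  · subst ha
    simp only [Finset.mem_union, Finset.mem_inter] at hunion hinter
    simp only [Finset.mem_inter, Finset.mem_symmDiff, Finset.mem_singleton]
    tauto
  · simp [Finset.mem_symmDiff, ha]

theorem FormalCycle.symmDiff_ne_zero (hz : FormalCycle z)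
    (hcover : ∀ S T, z S T ≠ 0 → S ∪ T = Finset.univ) (hST : z S T ≠ 0)
    (hne : (S ∩ T).Nonempty) (hj : j ∉ S ∩ T) : z (S ∆ {j}) (T ∆ {j}) ≠ 0 := by
  obtain ⟨l, hl⟩ := hne
  have hlj : l ≠ j := fun h => hj (h ▸ hl)
  rw [Finset.mem_inter] at hl hj
  have hjST : j ∈ S ∪ T := hcover S T hST ▸ Finset.mem_univ j
  rcases Finset.mem_union.mp hjST with hjS | hjT
  · have hjT : j ∉ T := fun h => hj ⟨hjS, h⟩
    rw [symmDiff_singleton_of_mem hjS, symmDiff_singleton_of_notMem hjT]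
    rwa [Ne, ← hz.insert_eq_zero_iff hcover ⟨l, Finset.mem_erase.mpr ⟨hlj, hl.1⟩⟩ ⟨l, hl.2⟩
      (Finset.notMem_erase j S) hjT, Finset.insert_erase hjS]
  · have hjS : j ∉ S := fun h => hj ⟨h, hjT⟩
    rw [symmDiff_singleton_of_mem hjT, symmDiff_singleton_of_notMem hjS]
    rwa [Ne, hz.insert_eq_zero_iff hcover ⟨l, hl.1⟩ ⟨l, Finset.mem_erase.mpr ⟨hlj, hl.2⟩⟩
      hjS (Finset.notMem_erase j T), Finset.insert_erase hjT]

theorem Tight.eq_of_formalCycle (hp : i + 2 ≤ p) (hc : Tight i c) (hd : Tight i d)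
    (hz : FormalCycle (d - c)) : d = c := by
  have hsupp {S T} (h : (d - c) S T ≠ 0) : S ∪ T = Finset.univ ∧ (S ∩ T).card = i + 1 := by
    by_cases hdST : d S T = 0
    · have hcST : c S T ≠ 0 := by simpa [hdST] using h
      exact ⟨hc.union_eq hcST, hc.card_inter hcST⟩
    · exact ⟨hd.union_eq hdST, hd.card_inter hdST⟩
  rw [← sub_eq_zero]
  funext S T
  by_contra hST
  obtain ⟨hunion, hcard⟩ := hsupp hST
  obtain ⟨j, hj, k, hk, hjk⟩ : ∃ j ∈ (S ∩ T)ᶜ, ∃ k ∈ (S ∩ T)ᶜ, j ≠ k := by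
    rw [← Finset.one_lt_card, Finset.card_compl, Fintype.card_fin]
    omega
  rw [Finset.mem_compl] at hj hk
  have hmove {v} (hv : v ∉ S ∩ T) := hz.symmDiff_ne_zero (fun _ _ h => (hsupp h).1) hST
    (Finset.card_pos.mp (by omega)) hv
  have hinter {v} (hv : v ∉ S ∩ T) : S ∩ T = S ∆ {v} ∩ T ∆ {v} :=
    (inter_symmDiff_singleton (hunion ▸ Finset.mem_univ v) hv).symm
  -- Moving `j` or `k` gives three terms of `d - c` with the same intersection, one too many.
  rcases hc.eq_or_eq_or_eq hd hST (hmove hj) (hmove hk) (hinter hj) (hinter hk) with h | h | h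
  · exact Finset.singleton_ne_empty j (symmDiff_eq_left.mp h.symm)
  · exact Finset.singleton_ne_empty k (symmDiff_eq_left.mp h.symm)
  · exact hjk (Finset.singleton_injective (symmDiff_right_injective S h))

theorem eq_univ_and_eq_compl_singleton_or (h : S.card + T.card = 2 * p + 1) :
    (S = Finset.univ ∧ ∃ j, T = {j}ᶜ) ∨ (T = Finset.univ ∧ ∃ j, S = {j}ᶜ) := by
  have hS := Finset.card_add_card_compl S
  have hT := Finset.card_add_card_compl T
  rw [Fintype.card_fin] at hS hT
  have hfacet {U : Finset (Fin (p + 1))} (hU : Uᶜ.card = 1) : ∃ j, U = {j}ᶜ :=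
    (Finset.card_eq_one.mp hU).imp fun j hj => by rw [← hj, compl_compl]
  rcases Nat.eq_zero_or_pos Sᶜ.card with hzero | hpos
  · exact .inl ⟨(Finset.compl_eq_empty_iff S).mp (Finset.card_eq_zero.mp hzero),
      hfacet (by omega)⟩
  · exact .inr ⟨(Finset.compl_eq_empty_iff T).mp (Finset.card_eq_zero.mp (by omega)),
      hfacet (by omega)⟩

theorem FormalCycle.eq_zero_of_card_add_card (hp : 1 ≤ p) (hz : FormalCycle z)
    (hdeg : ∀ S T, z S T ≠ 0 → S.card + T.card = 2 * p + 1)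
    (hcard : S.card + T.card = 2 * p + 1) (hST : z S T = 0) : z = 0 := by
  have : Nontrivial (Fin (p + 1)) := Fin.nontrivial_iff_two_le.mpr (by omega)
  have hne (j : Fin (p + 1)) : ({j}ᶜ : Finset (Fin (p + 1))).Nonempty :=
    (exists_ne j).imp fun k hk => by simpa using hk
  have hiff (j k) : z Finset.univ {j}ᶜ = 0 ↔ z {k}ᶜ Finset.univ = 0 := by
    have h := hz {k}ᶜ {j}ᶜ (hne k) (hne j)
    rw [boundaryCoeff, compl_compl, compl_compl, Finset.sum_singleton, Finset.sum_singleton,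
      Finset.insert_compl_self, Finset.insert_compl_self] at h
    exact eq_zero_iff_of_sign_mul_add_sign_mul h
  have hall : (∀ j, z Finset.univ {j}ᶜ = 0) ∧ ∀ k, z {k}ᶜ Finset.univ = 0 := by
    rcases eq_univ_and_eq_compl_singleton_or hcard with ⟨rfl, j, rfl⟩ | ⟨rfl, k, rfl⟩
    · exact ⟨fun j' => (hiff j' j).mpr ((hiff j j).mp hST), fun k => (hiff j k).mp hST⟩
    · exact ⟨fun j => (hiff j k).mpr hST, fun k' => (hiff k k').mp ((hiff k k).mpr hST)⟩
  funext A B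
  by_contra hAB
  rcases eq_univ_and_eq_compl_singleton_or (hdeg A B hAB) with ⟨rfl, j, rfl⟩ | ⟨rfl, k, rfl⟩
  · exact hAB (hall.1 j)
  · exact hAB (hall.2 k)

end TightCycle

section TopDimension

variable {i : ℕ} {c c' d : Finset (Fin (i + 1 + 1)) → Finset (Fin (i + 1 + 1)) → ℤ}

theorem Tight.eq_of_apply_eq (hc : Tight i c) (hd : Tight i d) (hz : FormalCycle (d - c))
    {S T : Finset (Fin (i + 1 + 1))} (hcard : S.card + T.card = 2 * (i + 1) + 1)
    (hST : d S T = c S T) : d = c := by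
  rw [← sub_eq_zero]
  refine hz.eq_zero_of_card_add_card (by omega) (fun A B hAB => ?_) hcard (sub_eq_zero.mpr hST)
  have hsupp : c A B ≠ 0 ∨ d A B ≠ 0 := by
    rw [Pi.sub_apply, Pi.sub_apply] at hAB
    omega
  have hdeg := hsupp.elim hc.card_add_card hd.card_add_card
  rw [Fintype.card_fin] at hdeg
  omega

theorem Tight.eq_or_eq_of_formalCycle (hc : Tight i c) (hc' : Tight i c') (hd : Tight i d)
    (hopp : ∀ S T, c' S T ≠ 0 → c T S ≠ 0) (hz : FormalCycle (d - c))
    (hz' : FormalCycle (d - c')) : d = c ∨ d = c' := by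
  have hi : i + 1 < Fintype.card (Fin (i + 1 + 1)) := by simp
  obtain ⟨S, T, -, -, hodd⟩ := hc.exists_odd {0}ᶜ (by simp [Finset.card_compl])
  have hcST := ne_zero_of_odd hodd
  have hcard := hc.card_add_card hcST
  rw [Fintype.card_fin] at hcard
  have hcTS := hc.apply_swap_eq_zero hi hcST
  by_cases hdST : d S T = 0
  · have hc'ST : c' S T = 0 := not_not.mp fun h => hopp S T h hcTS
    exact .inr (hc'.eq_of_apply_eq hd hz' (by omega) (hdST.trans hc'ST.symm))
  · have hdTS := hd.apply_swap_eq_zero hi hdST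
    exact .inl (hc.eq_of_apply_eq hd hz (by omega) (hdTS.trans hcTS.symm))

end TopDimension

/-! ### Admissible formulas -/

/-- A formula is admissible for `X` if its coproduct satisfies the homotopy formula and is
normalized in dimension `0`. -/
structure Formula.Admissible {i : ℕ} (Φ : Formula i) (X : Type*) [TopologicalSpace X] : Prop where
  homotopyFormula : HomotopyFormula i (Φ.coproduct X)
  normalized : Normalized i (Φ.coproduct X)

section DeltaEmptyFormula

variable {i p : ℕ} {S T L : Finset (Fin (p + 1))}

/-- The formula of the coproduct `Δ_i^∅`. The generating set of the term `S ⊗ T` is `S ∩ T`. -/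
def deltaEmptyFormula (i : ℕ) : Formula i where
  coeff p S T :=
    if (S ∩ T).card = i + 1 ∧ S = S ∩ T ∪ initialVertex ∅ (S ∩ T) ∧
        T = S ∩ T ∪ coInitialVertex ∅ (S ∩ T) then
      (-1) ^ signExponent (S ∩ T) (initialVertex ∅ (S ∩ T)) (coInitialVertex ∅ (S ∩ T))
    else 0
  degree p S T h := by
    obtain ⟨⟨hcard, hS, hT⟩, -⟩ := ite_ne_right_iff.mp h
    have hunion : S ∪ T = Finset.univ :=
      (congrArg₂ (· ∪ ·) hS hT).trans (isSplitting_initialVertex (S ∩ T)).union_union_union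
    rw [← Finset.card_union_add_card_inter, hunion, hcard, Finset.card_univ, Fintype.card_fin]
    ring

theorem eq_of_deltaEmptyFormula_coeff_ne_zero (h : (deltaEmptyFormula i).coeff p S T ≠ 0) :
    (S ∩ T).card = i + 1 ∧ S = S ∩ T ∪ initialVertex ∅ (S ∩ T) ∧
      T = S ∩ T ∪ coInitialVertex ∅ (S ∩ T) :=
  (ite_ne_right_iff.mp h).1

theorem deltaEmptyFormula_coeff (hL : L.card = i + 1) :
    (deltaEmptyFormula i).coeff p (L ∪ initialVertex ∅ L) (L ∪ coInitialVertex ∅ L) =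
      (-1) ^ signExponent L (initialVertex ∅ L) (coInitialVertex ∅ L) := by
  simp only [deltaEmptyFormula, (isSplitting_initialVertex L).union_inter_union]
  exact if_pos ⟨hL, trivial, trivial⟩

theorem tight_deltaEmptyFormula (i p : ℕ) : Tight i ((deltaEmptyFormula i).coeff p) where
  union_eq h := by
    obtain ⟨-, hS, hT⟩ := eq_of_deltaEmptyFormula_coeff_ne_zero h
    exact (congrArg₂ (· ∪ ·) hS hT).trans (isSplitting_initialVertex _).union_union_union
  card_inter h := (eq_of_deltaEmptyFormula_coeff_ne_zero h).1
  inj h h' hinter := by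
    rw [(eq_of_deltaEmptyFormula_coeff_ne_zero h).2.1,
      (eq_of_deltaEmptyFormula_coeff_ne_zero h').2.1, hinter]
  exists_odd L hL := ⟨_, _, (isSplitting_initialVertex L).union_union_union,
    (isSplitting_initialVertex L).union_inter_union,
    deltaEmptyFormula_coeff hL ▸ odd_neg_one.pow⟩

theorem deltaEmptyFormula_value (i : ℕ) (σ : SingularSimplex X p) :
    (deltaEmptyFormula i).value σ = cubillageValue i ∅ σ := by
  rw [Formula.value, cubillageValue, ← Finset.sum_product']
  refine (Finset.sum_of_injOn (fun L => (L ∪ initialVertex ∅ L, L ∪ coInitialVertex ∅ L))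
    (fun L _ L' _ h => ?_) (fun _ _ => by simp) (fun ST _ hST => ?_) fun L hL => ?_).symm
  · have hinter := congrArg (fun ST : Finset (Fin (p + 1)) × Finset (Fin (p + 1)) => ST.1 ∩ ST.2) h
    simpa only [(isSplitting_initialVertex _).union_inter_union] using hinter
  · have hzero : (deltaEmptyFormula i).coeff p ST.1 ST.2 = 0 := by
      by_contra h
      obtain ⟨hcard, hS, hT⟩ := eq_of_deltaEmptyFormula_coeff_ne_zero h
      exact hST ⟨ST.1 ∩ ST.2, by simpa using hcard, Prod.ext hS.symm hT.symm⟩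
    rw [hzero]
    exact zero_smul ℤ _
  · rw [deltaEmptyFormula_coeff (Finset.mem_powersetCard.mp hL).2]

theorem deltaEmptyFormula_coproduct (X : Type*) [TopologicalSpace X] (i : ℕ) :
    (deltaEmptyFormula i).coproduct X = deltaEmpty X i := by
  simp only [Formula.coproduct, deltaEmptyFormula_value, deltaEmpty]

theorem admissible_deltaEmptyFormula (X : Type*) [TopologicalSpace X] (i : ℕ) :
    (deltaEmptyFormula i).Admissible X where
  homotopyFormula := deltaEmptyFormula_coproduct X i ▸ homotopyFormula_deltaEmpty X i
  normalized := deltaEmptyFormula_coproduct X i ▸ normalized_deltaEmpty X i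

end DeltaEmptyFormula

namespace Formula

variable {i p : ℕ} {Φ Ψ : Formula i}

theorem coproduct_simplexChain (Φ : Formula i) (σ : SingularSimplex X p) :
    Φ.coproduct X (simplexChain σ) = Φ.value σ :=
  linearCombination_simplexChain _ σ

theorem coproduct_congr (h : ∀ p, Φ.coeff p = Ψ.coeff p) : Φ.coproduct X = Ψ.coproduct X := by
  simp only [coproduct, value, h]

/-- The formula of the opposite coproduct `(-1)^i T Δ^Φ`. -/
def opposite (Φ : Formula i) : Formula i where
  coeff p S T := (-1) ^ i * (-1) ^ ((T.card - 1) * (S.card - 1)) * Φ.coeff p T S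
  degree p S T h := by rw [add_comm, Φ.degree p T S (right_ne_zero_of_mul h)]

theorem opposite_value (Φ : Formula i) (σ : SingularSimplex X p) :
    Φ.opposite.value σ = (-1 : ℤ) ^ i • swap X (Φ.value σ) := by
  rw [value, value, Finset.sum_comm, map_sum, Finset.smul_sum]
  refine Finset.sum_congr rfl fun S _ => ?_
  rw [map_sum, Finset.smul_sum]
  refine Finset.sum_congr rfl fun T _ => ?_
  rw [map_smul, swap_faceChain, smul_smul, smul_smul, mul_right_comm]
  rfl

theorem opposite_coproduct (Φ : Formula i) (X : Type*) [TopologicalSpace X] :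
    Φ.opposite.coproduct X = (-1 : ℤ) ^ i • (swap X ∘ₗ Φ.coproduct X) := by
  refine chains_hom_ext fun p σ => ?_
  rw [LinearMap.smul_apply, LinearMap.comp_apply, coproduct_simplexChain, coproduct_simplexChain,
    opposite_value]

theorem Admissible.opposite (h : Φ.Admissible X) : Φ.opposite.Admissible X where
  homotopyFormula := opposite_coproduct Φ X ▸ h.homotopyFormula.opposite
  normalized := opposite_coproduct Φ X ▸ h.normalized.opposite

theorem tight_opposite (h : Tight i (Φ.coeff p)) : Tight i (Φ.opposite.coeff p) :=
  h.mul_swap fun _ _ => odd_neg_one.pow.mul odd_neg_one.pow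

theorem formalValue_sub (Φ Ψ : Formula i) (σ : SingularSimplex X p) :
    formalValue (Φ.coeff p - Ψ.coeff p) σ = Φ.value σ - Ψ.value σ := by
  simp only [formalValue, value, ← Finset.sum_sub_distrib, Pi.sub_apply]
  refine Finset.sum_congr rfl fun S _ => Finset.sum_congr rfl fun T _ => ?_
  exact sub_smul (Φ.coeff p S T) (Ψ.coeff p S T) (faceChain σ S ⊗ₜ[ℤ] faceChain σ T)

theorem degree_of_sub_ne_zero {S T : Finset (Fin (p + 1))}
    (h : (Φ.coeff p - Ψ.coeff p) S T ≠ 0) : S.card + T.card = p + i + 2 := by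
  by_cases hΦ : Φ.coeff p S T = 0
  · refine Ψ.degree p S T fun hΨ => h ?_
    rw [Pi.sub_apply, Pi.sub_apply, hΦ, hΨ, sub_self]
  · exact Φ.degree p S T hΦ

theorem coproduct_boundary_congr (h : ∀ q, q + 1 = p → Φ.coeff q = Ψ.coeff q)
    (σ : SingularSimplex X p) :
    Φ.coproduct X (boundary X (simplexChain σ)) = Ψ.coproduct X (boundary X (simplexChain σ)) := by
  rw [boundary_simplexChain, map_sum, map_sum]
  refine Finset.sum_congr rfl fun j _ => ?_
  rw [map_smul, map_smul]
  rcases (Finset.univ.erase j).eq_empty_or_nonempty with hempty | hne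
  · rw [hempty, faceChain_empty, map_zero, map_zero]
  · have hcard := Finset.card_erase_add_one (Finset.mem_univ j)
    rw [Finset.card_univ, Fintype.card_fin] at hcard
    have hpos := hne.card_pos
    rw [faceChain_of_nonempty σ hne, coproduct_simplexChain, coproduct_simplexChain, value, value,
      h _ (by omega)]

theorem coeff_eq_of_forall_sub_eq_zero
    (h : ∀ S T, S.card + T.card = p + i + 2 → (Φ.coeff p - Ψ.coeff p) S T = 0) :
    Φ.coeff p = Ψ.coeff p :=
  sub_eq_zero.mp <| funext₂ fun S T => not_not.mp fun hST => hST (h S T (degree_of_sub_ne_zero hST))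

theorem coeff_eq_of_lt (hp : p < i) : Φ.coeff p = Ψ.coeff p := by
  refine coeff_eq_of_forall_sub_eq_zero fun S T hcard => ?_
  have hS := card_finset_fin_le S
  have hT := card_finset_fin_le T
  omega

namespace Admissible

theorem formalCycle_sub (hX : ∃ x y : X, x ≠ y ∧ Joined x y) (hΦ : Φ.Admissible X)
    (hΨ : Ψ.Admissible X) (h : ∀ q, q + 1 = p → Φ.coeff q = Ψ.coeff q) :
    FormalCycle (Φ.coeff p - Ψ.coeff p) := by
  refine formalCycle_of_tensorBoundary_eq_zero hX (fun S T hST => ?_) fun σ => ?_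
  · have := degree_of_sub_ne_zero hST
    omega
  · have hhom := (homotopyFormula_iff.mp hΦ.homotopyFormula (simplexChain σ)).trans
      (homotopyFormula_iff.mp hΨ.homotopyFormula (simplexChain σ)).symm
    rw [coproduct_boundary_congr h, sub_left_inj, coproduct_simplexChain,
      coproduct_simplexChain] at hhom
    rw [formalValue_sub, map_sub, hhom, sub_self]

theorem coeff_sub_univ_eq_zero (hX : ∃ x y : X, x ≠ y ∧ Joined x y) (hΦ : Φ.Admissible X)
    (hΨ : Ψ.Admissible X) : (Φ.coeff i - Ψ.coeff i) Finset.univ Finset.univ = 0 := by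
  rcases Nat.eq_zero_or_pos i with rfl | hi
  · refine eq_zero_of_formalValue_eq_zero hX (fun σ => ?_) Finset.univ_nonempty
      Finset.univ_nonempty (.inr zero_le_one)
    rw [formalValue_sub, ← coproduct_simplexChain, ← coproduct_simplexChain, hΦ.normalized rfl,
      hΨ.normalized rfl, sub_self]
  · have hne : ({0}ᶜ : Finset (Fin (i + 1))).Nonempty :=
      ⟨⟨i, i.lt_succ_self⟩, by simpa [Fin.ext_iff] using hi.ne'⟩
    have hfacet := hΦ.formalCycle_sub hX hΨ (fun q hq => coeff_eq_of_lt (by omega)) {0}ᶜ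
      Finset.univ hne Finset.univ_nonempty
    rw [boundaryCoeff, compl_compl, Finset.sum_singleton, Finset.insert_compl_self,
      Finset.compl_univ, Finset.sum_empty, add_zero] at hfacet
    exact (mul_eq_zero.mp hfacet).resolve_left (pow_ne_zero _ (by decide))

theorem coeff_eq_of_le (hX : ∃ x y : X, x ≠ y ∧ Joined x y) (hΦ : Φ.Admissible X)
    (hΨ : Ψ.Admissible X) (hp : p ≤ i) : Φ.coeff p = Ψ.coeff p := by
  rcases hp.lt_or_eq with hp | rfl
  · exact coeff_eq_of_lt hp
  · refine coeff_eq_of_forall_sub_eq_zero fun S T hcard => ?_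
    have hS := card_finset_fin_le S
    have hT := card_finset_fin_le T
    obtain rfl : S = Finset.univ := (Finset.card_eq_iff_eq_univ S).mp (by simp; omega)
    obtain rfl : T = Finset.univ := (Finset.card_eq_iff_eq_univ T).mp (by simp; omega)
    exact hΦ.coeff_sub_univ_eq_zero hX hΨ

theorem coeff_eq_of_tight (hX : ∃ x y : X, x ≠ y ∧ Joined x y) (hΦ : Φ.Admissible X)
    (hΨ : Ψ.Admissible X) (hcard : ∀ p, Φ.numTerms p ≤ (p + 1).choose (i + 1))
    (hΨt : ∀ p, Tight i (Ψ.coeff p)) (htop : Φ.coeff (i + 1) = Ψ.coeff (i + 1)) (p : ℕ) :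
    Φ.coeff p = Ψ.coeff p := by
  induction p with
  | zero => exact hΦ.coeff_eq_of_le hX hΨ i.zero_le
  | succ p ih =>
    rcases lt_trichotomy p i with hp | rfl | hp
    · exact hΦ.coeff_eq_of_le hX hΨ hp
    · exact htop
    · have hcycle := hΦ.formalCycle_sub hX hΨ (p := p + 1) fun q hq => by
        obtain rfl : q = p := by omega
        exact ih
      have hΦt := (hΨt (p + 1)).of_card_support_le (by omega) hcycle (hcard (p + 1))
      exact (hΨt (p + 1)).eq_of_formalCycle (by omega) hΦt hcycle

theorem coproduct_eq_or_eq_opposite (hX : ∃ x y : X, x ≠ y ∧ Joined x y) (hΦ : Φ.Admissible X)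
    (hcard : ∀ p, Φ.numTerms p ≤ (p + 1).choose (i + 1)) :
    Φ.coproduct X = deltaEmpty X i ∨ Φ.coproduct X = (-1 : ℤ) ^ i • (swap X ∘ₗ deltaEmpty X i) := by
  have hΨ := admissible_deltaEmptyFormula X i
  have hcycle {Ψ : Formula i} (hΨ : Ψ.Admissible X) :
      FormalCycle (Φ.coeff (i + 1) - Ψ.coeff (i + 1)) :=
    hΦ.formalCycle_sub hX hΨ fun q hq => hΦ.coeff_eq_of_le hX hΨ (by omega)
  have hT (p) := tight_deltaEmptyFormula i p
  have hΦt := (hT (i + 1)).of_card_support_le (by omega) (hcycle hΨ) (hcard (i + 1))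
  rcases (hT (i + 1)).eq_or_eq_of_formalCycle (tight_opposite (hT (i + 1))) hΦt
    (fun _ _ => right_ne_zero_of_mul) (hcycle hΨ) (hcycle hΨ.opposite) with htop | htop
  · left
    rw [coproduct_congr (hΦ.coeff_eq_of_tight hX hΨ hcard hT htop), deltaEmptyFormula_coproduct]
  · right
    rw [coproduct_congr (hΦ.coeff_eq_of_tight hX hΨ.opposite hcard (fun p => tight_opposite (hT p))
      htop), opposite_coproduct, deltaEmptyFormula_coproduct]

end Admissible

end Formula

end CupCoproduct

end

open CupCoproduct in
theorem theorem4p6 {X : Type*} [TopologicalSpace X]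
    (hX : ∃ x y : X, x ≠ y ∧ Joined x y)
    (i : ℕ) (D : CupCoproduct.Chains X →ₗ[ℤ] CupCoproduct.Chains X ⊗[ℤ] CupCoproduct.Chains X)
    (Φ : CupCoproduct.Formula i)
    (hD : ∀ (p : ℕ) (σ : CupCoproduct.SingularSimplex X p),
      D (CupCoproduct.simplexChain σ) = Φ.value σ)
    (hhom : CupCoproduct.HomotopyFormula i D)
    (hnorm : CupCoproduct.Normalized i D)
    (hmin : ∀ Ψ : CupCoproduct.Formula i,
      CupCoproduct.HomotopyFormula i (Ψ.coproduct X) → CupCoproduct.Normalized i (Ψ.coproduct X) →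
        ∀ p : ℕ, Φ.numTerms p ≤ Ψ.numTerms p) :
    D = CupCoproduct.deltaEmpty X i ∨
      D = (-1 : ℤ) ^ i • (CupCoproduct.swap X ∘ₗ CupCoproduct.deltaEmpty X i) := by
  obtain rfl : D = Φ.coproduct X :=
    chains_hom_ext fun p σ => by rw [hD, Formula.coproduct_simplexChain]
  have hΨ := admissible_deltaEmptyFormula X i
  have hcard (p : ℕ) : Φ.numTerms p ≤ (p + 1).choose (i + 1) :=
    (hmin _ hΨ.homotopyFormula hΨ.normalized p).trans <|
      (tight_deltaEmptyFormula i p).card_support_le.trans_eq <| by rw [Fintype.card_fin]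
  exact Formula.Admissible.coproduct_eq_or_eq_opposite hX ⟨hhom, hnorm⟩ hcard
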